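/- Let $P\in\mathbb Z[X]$ be a monic polynomial of degree at least $1$ with nonzero constant term, without multiple roots (in $\mathbb C$) and without roots on the unit circle, and let $k\ge 0$ be an integer. Let $\alpha_1,\dots,\alpha_p$ be the complex roots of $P$ with $|\alpha_j|>1$; let $r_1$ be the number of real ones among them and $r_2=(p-r_1)/2$. Let $\Xi_k$ be the set of tuples $\mathbf g=(g_1,\dots,g_p)\in\mathbb C[X]^p$ of polynomials of degree at most $k$ such that $g_j\in\mathbb R[X]$ whenever $\alpha_j\in\mathbb R$, and $g_\ell=\overline{g_j}$ (complex conjugation of the coefficients) whenever $\alpha_\ell=\overline{\alpha_j}$. Through the coefficients, $\Xi_k$ is identified with $\mathbb R^{(k+1)r_1}\times\mathbb C^{(k+1)r_2}$ and carries its Euclidean topology. For $\mathbf g\in\Xi_k$ and $n\ge 0$ put $$x_n(\mathbf g)=\sum_{j=1}^p g_j(n)\,\alpha_j^n ,$$ a real number; the sequence $(x_n(\mathbf g))_{n\ge 0}$ satisfies the linear recurrence with companion polynomial $P(X)^{k+1}$. Write $e(\xi)\in[-1/2,1/2)$ for the representative of $\xi\in\mathbb R$ modulo one. A real sequence $(x_n)_{n\ge0}$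 is uniformly distributed modulo one if $\lim_{N\to\infty}\frac1N\,\mathrm{Card}\{0\le n<N : e(x_n)\in[a,b)\}=b-a$ for all $-1/2\le a<b\le 1/2$. Let $$\mathcal N_{P,k}=\{\mathbf g\in\Xi_k : (x_n(\mathbf g))_{n\ge 0}\text{ is uniformly distributed modulo one}\}.$$ Then $\mathcal N_{P,k}$ is $\boldsymbol\Pi^0_3$-complete in $\Xi_k$, that is, $\mathcal N_{P,k}\in\boldsymbol\Pi^0_3(\Xi_k)\setminus\boldsymbol\Sigma^0_3(\Xi_k)$, where $\boldsymbol\Sigma^0_1$ consists of the open sets, $\boldsymbol\Pi^0_n$ of the complements of $\boldsymbol\Sigma^0_n$ sets, and, for $n>1$, $\boldsymbol\Sigma^0_n$ of the countable unions of sets from $\bigcup_{1\le m<n}\boldsymbol\Pi^0_m$. Moreover, there is a continuous map $\varphi:\mathbb N^{\mathbb N}\to\Xi_k$ (the product topology of discrete spaces on $\mathbb N^{\mathbb N}$) with $\varphi^{-1}(\mathcal N_{P,k})=\{\beta\in\mathbb N^{\mathbb N} : \beta(n)\to\infty\}$. -/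

import Mathlib

open Filter Topology Polynomial

namespace RecurrenceNormal

/-- `BorelSigma n A` for `1 ≤ n`: the set `A` belongs to the finite level `n` of the additive
Borel hierarchy of `X`. Level one consists of the open sets; for `n > 1` the level consists of the
countable unions of sets whose complements lie in additive levels `m i` with `1 ≤ m i < n`.
No set is on level zero, so `m i = 0` and `n ≤ 1` never occur in the second constructor. -/
inductive BorelSigma {X : Type*} [TopologicalSpace X] : ℕ → Set X → Prop
  | isOpen {A : Set X} (hA : IsOpen A) : BorelSigma 1 A
  | iUnion {n : ℕ} {B : Set X} (A : ℕ → Set X) (m : ℕ → ℕ) (hm : ∀ i, m i < n)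
      (hA : ∀ i, BorelSigma (m i) (A i)ᶜ) (hB : B = ⋃ i, A i) : BorelSigma n B

/-- The multiplicative level `n` of the Borel hierarchy: complements of additive level `n`. -/
def BorelPi {X : Type*} [TopologicalSpace X] (n : ℕ) (A : Set X) : Prop :=
  BorelSigma n Aᶜ

/-- `A` is complete for the multiplicative level `n`: it is on that level, but not on the
additive level `n`. -/
def BorelPiComplete {X : Type*} [TopologicalSpace X] (n : ℕ) (A : Set X) : Prop :=
  BorelPi n A ∧ ¬ BorelSigma n A

/-- The representative of `ξ` modulo one in `[-1/2, 1/2)`. -/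
noncomputable def centeredFract (ξ : ℝ) : ℝ :=
  Int.fract (ξ + 1 / 2) - 1 / 2

open Classical in
/-- Uniform distribution modulo one of a sequence of real numbers. -/
def UniformlyDistributedModOne (x : ℕ → ℝ) : Prop :=
  ∀ a b : ℝ, -(1 / 2) ≤ a → a < b → b ≤ 1 / 2 →
    Tendsto
      (fun N : ℕ =>
        (((Finset.range N).filter fun n => centeredFract (x n) ∈ Set.Ico a b).card : ℝ) / (N : ℝ))
      atTop (𝓝 (b - a))

open Classical in
/-- The set of complex roots of `P` with modulus greater than one. -/
noncomputable def expandingRoots (P : ℤ[X]) : Finset ℂ :=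
  (P.aroots ℂ).toFinset.filter fun α => 1 < ‖α‖

/-- The space of initial values: families of complex polynomials of degree at most `k`, one for
each root of modulus greater than one, such that complex conjugate roots carry conjugate
polynomials. For a real root `α = β` this says that the polynomial has real coefficients. -/
structure InitialValue (P : ℤ[X]) (k : ℕ) where
  /-- the polynomial attached to a root -/
  poly : expandingRoots P → ℂ[X]
  natDegree_le : ∀ α, (poly α).natDegree ≤ k
  conj_eq : ∀ α β : expandingRoots P,
    (β : ℂ) = (starRingEnd ℂ) (α : ℂ) → poly β = (poly α).map (starRingEnd ℂ)

/-- The coefficients of an initial value. -/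
noncomputable def InitialValue.coeffs {P : ℤ[X]} {k : ℕ} (g : InitialValue P k) :
    expandingRoots P → Fin (k + 1) → ℂ :=
  fun α i => (g.poly α).coeff i

/-- The Euclidean topology: `coeffs` identifies the space with a real linear subspace of a finite
power of `ℂ` (the coefficients at real roots are arbitrary reals, those at one root of each
conjugate pair of nonreal roots are arbitrary complex numbers, and they determine those at the
other root by conjugation). -/
noncomputable instance InitialValue.instTopologicalSpace (P : ℤ[X]) (k : ℕ) :
    TopologicalSpace (InitialValue P k) :=
  TopologicalSpace.induced InitialValue.coeffs inferInstance

/-- The sum of `g_α(n) α ^ n` over the roots `α` with `|α| > 1`, as a complex number. -/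
noncomputable def InitialValue.complexSeq {P : ℤ[X]} {k : ℕ} (g : InitialValue P k) (n : ℕ) : ℂ :=
  ∑ α : expandingRoots P, (g.poly α).eval (n : ℂ) * (α : ℂ) ^ n

/-- The real sequence attached to an initial value; see `InitialValue.ofReal_seq`. -/
noncomputable def InitialValue.seq {P : ℤ[X]} {k : ℕ} (g : InitialValue P k) (n : ℕ) : ℝ :=
  (g.complexSeq n).re

theorem conj_mem_expandingRoots {P : ℤ[X]} {α : ℂ} (h : α ∈ expandingRoots P) :
    (starRingEnd ℂ) α ∈ expandingRoots P := by
  classical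
  simp only [expandingRoots, Finset.mem_filter, Multiset.mem_toFinset, mem_aroots] at h ⊢
  obtain ⟨⟨hP, h0⟩, h1⟩ := h
  refine ⟨⟨hP, ?_⟩, by simpa using h1⟩
  have h2 := congrArg (starRingEnd ℂ) h0
  rw [aeval_def, hom_eval₂, map_zero] at h2
  rw [aeval_def]
  rwa [RingHom.ext_int ((starRingEnd ℂ).comp (algebraMap ℤ ℂ)) (algebraMap ℤ ℂ)] at h2

/-- The sum of the terms `g_α(n) α ^ n` is a real number. -/
theorem InitialValue.ofReal_seq {P : ℤ[X]} {k : ℕ} (g : InitialValue P k) (n : ℕ) :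
    (g.seq n : ℂ) = ∑ α : expandingRoots P, (g.poly α).eval (n : ℂ) * (α : ℂ) ^ n := by
  change ((g.complexSeq n).re : ℂ) = g.complexSeq n
  refine Complex.conj_eq_iff_re.mp ?_
  unfold InitialValue.complexSeq
  rw [map_sum]
  refine Fintype.sum_equiv
    (Function.Involutive.toPerm
      (fun α : expandingRoots P =>
        (⟨(starRingEnd ℂ) (α : ℂ), conj_mem_expandingRoots α.2⟩ : expandingRoots P))
      (fun α => Subtype.ext (Complex.conj_conj _))) _ _ (fun α => ?_)
  change _ = (g.poly ⟨(starRingEnd ℂ) (α : ℂ), conj_mem_expandingRoots α.2⟩).eval (n : ℂ) *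
    ((starRingEnd ℂ) (α : ℂ)) ^ n
  rw [g.conj_eq α ⟨(starRingEnd ℂ) (α : ℂ), conj_mem_expandingRoots α.2⟩ rfl, map_mul, map_pow,
    eval_natCast_map]

/-- The set of normal vectors: the initial values whose sequence is uniformly distributed modulo
one. -/
def normalVectors (P : ℤ[X]) (k : ℕ) : Set (InitialValue P k) :=
  {g | UniformlyDistributedModOne g.seq}

end RecurrenceNormal

/-! Upper bound: by Weyl's criterion (`uniformlyDistributedModOne_iff_weylSums`) normality means
that countably many sequences of exponential averages, each continuous in the initial value, tend to
zero. This is a condition of the form "for all, there is, closed", hence on the third multiplicative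
level.

Lower bound: in Baire space the set of β tending to infinity is not on the third additive level
(`not_borelSigma_three_tendsto_atTop`), and levels pass to continuous preimages. So everything
reduces to the map φ, which may take its values among the constant polynomials; there the sequences
obey the recurrence of P itself.

To build φ, start from one normal sequence x, given by a metric theorem applied to a single
expanding root (`exists_weylSums_re_mul_pow`). Let ε be its centered representatives. Applying
P(shift) to ε gives a bounded sequence s of integers, the defects. Since P has no root on the unit
circle, P(shift) has an exponentially decaying two-sided inverse c (`kernel_recurrence`,
`exists_kernel_bound`), and the convolution s * c returns ε up to an exponentially small error
(`abs_sub_convolution_defect_le`). Conversely, for every bounded integer sequence σ, the sequence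
-(σ * c) is modulo one the sequence of an initial value that depends continuously on σ
(`exists_int_sum_defectCoeff`, `continuous_defectCoeff`).

Now let σ equal s on a chosen set of times and 0 elsewhere. Then ε - σ * c is nearly 0 well inside
the chosen set and nearly ε far from it, with total errors controlled by
`sum_Ico_abs_convolution_le`. The chosen set is the initial fraction 1/(β j + 1) of each dyadic
block. If β tends to infinity, it has density zero and normality survives. Otherwise infinitely many
blocks contain a fixed proportion of terms close to integers, and normality fails. -/

namespace RecurrenceNormal

/-! ### Finite levels of the Borel hierarchy. -/

section Borel

variable {X Y : Type*} [TopologicalSpace X] [TopologicalSpace Y]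

theorem not_borelSigma_zero {A : Set X} : ¬ BorelSigma 0 A := by
  intro h
  cases h with
  | iUnion A m hm hA hB => exact absurd (hm 0) (Nat.not_lt_zero _)

theorem borelSigma_one_iff {A : Set X} : BorelSigma 1 A ↔ IsOpen A := by
  refine ⟨fun h => ?_, .isOpen⟩
  cases h with
  | isOpen hA => exact hA
  | iUnion A m hm hA hB =>
    have h0 : m 0 = 0 := Nat.lt_one_iff.mp (hm 0)
    exact absurd (h0 ▸ hA 0) not_borelSigma_zero

theorem BorelSigma.preimage {f : X → Y} (hf : Continuous f) {n : ℕ} {A : Set Y}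
    (h : BorelSigma n A) : BorelSigma n (f ⁻¹' A) := by
  induction h with
  | isOpen hA => exact .isOpen (hA.preimage hf)
  | iUnion A m hm hA hB ih =>
    exact .iUnion (fun i => f ⁻¹' A i) m hm ih (by rw [hB, Set.preimage_iUnion])

theorem BorelSigma.iUnion_countable {ι : Type*} [Countable ι] [Nonempty ι] {m n : ℕ} (hmn : m < n)
    (A : ι → Set X) (hA : ∀ i, BorelSigma m (A i)ᶜ) : BorelSigma n (⋃ i, A i) := by
  obtain ⟨e, he⟩ := exists_surjective_nat ι
  exact .iUnion (fun i => A (e i)) (fun _ => m) (fun _ => hmn) (fun i => hA _)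
    (he.iUnion_comp A).symm

/-- On level two, the complements are `Gδ` sets. -/
theorem isGδ_of_borelSigma_two {A : Set X} (h : BorelSigma 2 Aᶜ) : IsGδ A := by
  generalize hB : Aᶜ = B at h
  cases h with
  | iUnion F m hm hF hU =>
    have hm1 : ∀ i, m i = 1 := fun i => by
      have h1 := hm i
      have h2 : m i ≠ 0 := fun h0 => not_borelSigma_zero (h0 ▸ hF i)
      omega
    have : A = ⋂ i, (F i)ᶜ := by rw [← Set.compl_iUnion, ← hU, ← hB, compl_compl]
    rw [this]
    exact .iInter_of_isOpen fun i => borelSigma_one_iff.mp (hm1 i ▸ hF i)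

/-- The pieces may come from multiplicative level one or two; pseudometrizability is what turns the
closed ones into Gδ sets. -/
theorem BorelSigma.exists_iUnion_isGδ [TopologicalSpace.PseudoMetrizableSpace X] {B : Set X}
    (h : BorelSigma 3 B) : ∃ G : ℕ → Set X, (∀ i, IsGδ (G i)) ∧ B = ⋃ i, G i := by
  cases h with
  | iUnion G m hm hG hU =>
    refine ⟨G, fun i => ?_, hU⟩
    have h1 := hm i
    have h2 : m i ≠ 0 := fun h0 => not_borelSigma_zero (h0 ▸ hG i)
    obtain h3 | h3 : m i = 1 ∨ m i = 2 := by omega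
    · let _ := TopologicalSpace.pseudoMetrizableSpacePseudoMetric X
      exact (isOpen_compl_iff.mp (borelSigma_one_iff.mp (h3 ▸ hG i))).isGδ
    · exact isGδ_of_borelSigma_two (h3 ▸ hG i)

/-- Simultaneous convergence to zero of countably many sequences of continuous functions is a
condition on the third multiplicative level. -/
theorem borelPi_three_setOf_tendsto_zero {ι : Type*} [Countable ι] [Nonempty ι]
    {F : ι → ℕ → X → ℂ} (hF : ∀ i N, Continuous (F i N)) :
    BorelPi 3 {x | ∀ i, Tendsto (fun N => F i N x) atTop (𝓝 0)} := by
  -- The tolerances 1/(m+1) make the quantifier over ε countable, and the non-strict inequality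
  -- makes the innermost sets closed.
  have : {x | ∀ i, Tendsto (fun N => F i N x) atTop (𝓝 0)}ᶜ =
      ⋃ p : ι × ℕ, (⋃ N₀ : ℕ, {x | ∀ N, N₀ ≤ N → ‖F p.1 N x‖ ≤ 1 / ((p.2 : ℝ) + 1)})ᶜ := by
    rw [← Set.compl_iInter, compl_inj_iff]
    ext x
    simp only [Set.mem_ofPred_eq, Set.mem_iInter, Set.mem_iUnion, Prod.forall]
    refine forall_congr' fun i => ⟨fun h m => ?_, fun h => ?_⟩
    · have := (tendsto_zero_iff_norm_tendsto_zero.mp h).eventually_le_const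
        (u := 1 / ((m : ℝ) + 1)) (by positivity)
      exact eventually_atTop.mp this
    · rw [Metric.tendsto_atTop]
      intro ε hε
      obtain ⟨m, hm⟩ := exists_nat_one_div_lt hε
      obtain ⟨N, hN⟩ := h m
      exact ⟨N, fun n hn => by simpa using (hN n hn).trans_lt hm⟩
  unfold BorelPi
  rw [this]
  refine BorelSigma.iUnion_countable (m := 2) (by norm_num) _ fun p => ?_
  rw [compl_compl]
  refine BorelSigma.iUnion_countable (m := 1) (by norm_num) _ fun N₀ => .isOpen ?_
  rw [isOpen_compl_iff]
  simp only [Set.ofPred_forall]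
  exact isClosed_iInter fun N => isClosed_iInter fun _ =>
    isClosed_le (hF _ _).norm continuous_const

end Borel

/-! ### Sequences tending to infinity are not on the third additive level. -/

section BaireSpace

theorem exists_cylinder_subset {U : Set (ℕ → ℕ)} (hU : IsOpen U) {γ : ℕ → ℕ} (h : γ ∈ U) :
    ∃ L : ℕ, ∀ γ' : ℕ → ℕ, (∀ n < L, γ' n = γ n) → γ' ∈ U := by
  obtain ⟨V, ⟨x, L, rfl⟩, hV, hVU⟩ :=
    (PiNat.isTopologicalBasis_cylinders (fun _ : ℕ => ℕ)).exists_subset_of_mem_open h hU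
  exact ⟨L, fun γ' hγ' => hVU fun n hn => (hγ' n hn).trans (hV n hn)⟩

/-- The sequences with a prescribed initial segment and all later terms at least `i`. -/
def tailGe (i : ℕ) (s : (ℕ → ℕ) × ℕ) : Set (ℕ → ℕ) :=
  {β | (∀ n < s.2, β n = s.1 n) ∧ ∀ n, s.2 ≤ n → i ≤ β n}

theorem dense_frequently_zero : Dense {γ : ℕ → ℕ | ∀ N, ∃ n, N ≤ n ∧ γ n = 0} := by
  rw [dense_iff_inter_open]
  rintro U hU ⟨γ, hγ⟩
  obtain ⟨L, hL⟩ := exists_cylinder_subset hU hγ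
  refine ⟨fun n => if n < L then γ n else 0, hL _ fun n hn => if_pos hn, fun N => ?_⟩
  exact ⟨max N L, le_max_left _ _, if_neg (by simp)⟩

theorem isGδ_frequently_zero : IsGδ {γ : ℕ → ℕ | ∀ N, ∃ n, N ≤ n ∧ γ n = 0} := by
  simp only [Set.ofPred_forall]
  refine .iInter_of_isOpen fun N => ?_
  simp only [Set.ofPred_exists, Set.ofPred_and]
  exact isOpen_iUnion fun n => isOpen_const.inter
    ((isOpen_discrete ({0} : Set ℕ)).preimage (f := fun a : ℕ → ℕ => a n) (continuous_apply n))

/-- Baire category inside `tailGe i s`, which ψ parametrizes by all of Baire space. If the preimage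
of G were dense, it would be a dense Gδ and contain a γ with infinitely many zeros; then ψ γ takes
the value i infinitely often and cannot tend to infinity. So some cylinder misses the preimage, and
t records that cylinder. -/
theorem exists_tailGe_disjoint {G : Set (ℕ → ℕ)} (hG : IsGδ G)
    (hsub : G ⊆ {β | Tendsto β atTop atTop}) (i : ℕ) (s : (ℕ → ℕ) × ℕ) :
    ∃ t : (ℕ → ℕ) × ℕ, t.1 ∈ tailGe i s ∧ s.2 < t.2 ∧ Disjoint (tailGe i t) G := by
  let ψ : (ℕ → ℕ) → ℕ → ℕ := fun γ n => if n < s.2 then s.1 n else i + γ n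
  have hψ : Continuous ψ := continuous_pi fun n => by
    by_cases h : n < s.2
    · simpa only [ψ, if_pos h] using continuous_const
    · simp only [ψ, if_neg h]; fun_prop
  have hnd : ¬ Dense (ψ ⁻¹' G) := by
    intro hd
    have hGδ : IsGδ (ψ ⁻¹' G) := hG.preimage hψ
    obtain ⟨γ, hγ, hγ0⟩ := (hd.inter_of_Gδ hGδ isGδ_frequently_zero dense_frequently_zero).nonempty
    obtain ⟨N, hN⟩ := eventually_atTop.mp ((hsub hγ).eventually_gt_atTop i)
    obtain ⟨n, hn, h0⟩ := hγ0 (max N s.2)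
    have h1 := hN n (le_of_max_le_left hn)
    simp [ψ, not_lt.mpr (le_of_max_le_right hn), h0] at h1
  rw [dense_iff_inter_open] at hnd
  push Not at hnd
  obtain ⟨U, hU, ⟨γ, hγ⟩, hUG⟩ := hnd
  obtain ⟨L, hL⟩ := exists_cylinder_subset hU hγ
  refine ⟨(ψ γ, max s.2 L + 1), ⟨fun n hn => if_pos hn, fun n hn => ?_⟩, by grind, ?_⟩
  · simp [ψ, not_lt.mpr hn]
  rw [Set.disjoint_left]
  rintro β ⟨hβ1, hβ2⟩ hβG
  have hge : ∀ n, s.2 ≤ n → i ≤ β n := fun n hn => by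
    by_cases h : n < max s.2 L + 1
    · rw [hβ1 n h]; simp [ψ, not_lt.mpr hn]
    · exact hβ2 n (not_lt.mp h)
  -- An explicit ψ-preimage of β. Below `s.2`, where ψ ignores its argument, it copies γ so as to
  -- stay in the cylinder.
  have hβψ : ψ (fun n => if n < s.2 then γ n else β n - i) = β := by
    funext n
    by_cases h : n < s.2
    · rw [hβ1 n (by grind)]; simp [ψ, h]
    · have := hge n (not_lt.mp h)
      simp [ψ, h, this]
  have : (fun n => if n < s.2 then γ n else β n - i) ∈ U := hL _ fun n hn => by
    by_cases h : n < s.2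
    · simp [h]
    · rw [hβ1 n (by grind)]; simp [ψ, h]
  have h3 : (fun n => if n < s.2 then γ n else β n - i) ∈ U ∩ ψ ⁻¹' G :=
    ⟨this, by rw [Set.mem_preimage, hβψ]; exact hβG⟩
  rw [hUG] at h3
  exact h3

/-- Diagonalization: if the set were a union of Gδ sets G i, successive extensions of finite initial
segments would avoid G i at step i while forcing all later terms to be at least i. The limit
sequence tends to infinity but lies in no G i. -/
theorem not_borelSigma_three_tendsto_atTop :
    ¬ BorelSigma 3 {β : ℕ → ℕ | Tendsto β atTop atTop} := by
  intro h
  obtain ⟨G, hG, hU⟩ := h.exists_iUnion_isGδ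
  choose t ht1 ht2 ht3 using fun i s => exists_tailGe_disjoint (hG i)
    (by rw [hU]; exact Set.subset_iUnion G i) i s
  let st : ℕ → (ℕ → ℕ) × ℕ := fun i => Nat.rec (fun _ => 0, 0) (fun i s => t i s) i
  have hst : ∀ i, st (i + 1) = t i (st i) := fun i => rfl
  have hmono : StrictMono fun i => (st i).2 :=
    strictMono_nat_of_lt_succ fun i => by rw [hst]; exact ht2 _ _
  have hmem : ∀ i j, i < j → (st j).1 ∈ tailGe i (st i) := by
    intro i j hij
    induction j, hij using Nat.le_induction with
    | base => rw [hst]; exact ht1 _ _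
    | succ j hij ih =>
      have h1 := ht1 j (st j)
      rw [← hst] at h1
      have hlt := hmono hij
      refine ⟨fun n hn => ?_, fun n hn => ?_⟩
      · rw [h1.1 n (hn.trans hlt), ih.1 n hn]
      · by_cases h : n < (st j).2
        · rw [h1.1 n h]; exact ih.2 n hn
        · have := h1.2 n (not_lt.mp h)
          have : i < j := hij
          omega
  -- Stage n + 1 has already fixed the coordinate n, because the lengths increase strictly from 0.
  let β : ℕ → ℕ := fun n => (st (n + 1)).1 n
  have hagree : ∀ i n, n < (st i).2 → β n = (st i).1 n := by
    intro i n hn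
    rcases lt_trichotomy i (n + 1) with h | h | h
    · exact (hmem _ _ h).1 n hn
    · simp [β, h]
    · refine ((hmem _ _ h).1 n ?_).symm
      exact hmono.id_le (n + 1)
  have hβ : ∀ i, β ∈ tailGe i (st i) := by
    refine fun i => ⟨hagree i, fun n hn => ?_⟩
    have hni : i < n + i + 1 := by omega
    have h1 : n < (st (n + i + 1)).2 := by
      have : n + i + 1 ≤ (st (n + i + 1)).2 := hmono.id_le (n + i + 1)
      omega
    rw [hagree (n + i + 1) n h1]
    exact (hmem _ _ hni).2 n hn
  have hlim : β ∈ {β : ℕ → ℕ | Tendsto β atTop atTop} :=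
    tendsto_atTop.mpr fun i => eventually_atTop.mpr ⟨_, (hβ i).2⟩
  rw [hU] at hlim
  obtain ⟨i, hi⟩ := Set.mem_iUnion.mp hlim
  refine Set.disjoint_left.mp (ht3 i (st i)) (show β ∈ _ from ?_) hi
  rw [← hst]
  exact ⟨(hβ (i + 1)).1, fun n hn => (Nat.le_succ i).trans ((hβ (i + 1)).2 n hn)⟩

end BaireSpace

end RecurrenceNormal

/-! ### Weyl's criterion. -/

namespace RecurrenceNormal

open MeasureTheory

/-- Weyl's condition: all nontrivial exponential sums of the sequence are `o(N)`. -/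
def WeylSums (x : ℕ → ℝ) : Prop :=
  ∀ h : ℤ, h ≠ 0 → Tendsto
    (fun N : ℕ => (∑ n ∈ Finset.range N, fourier h (x n : UnitAddCircle)) / (N : ℂ)) atTop (𝓝 0)

theorem norm_fourier_apply (h : ℤ) (z : UnitAddCircle) : ‖fourier h z‖ = 1 := by
  rw [fourier_apply]; exact Circle.norm_coe _

theorem fourier_unit_coe (h : ℤ) (x : ℝ) :
    fourier h (x : UnitAddCircle) = Complex.exp (Complex.I * ((2 * Real.pi * h * x : ℝ) : ℂ)) := by
  rw [fourier_coe_apply]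
  congr 1
  push_cast
  ring

theorem fourier_unit_coe_add (h : ℤ) (x y : ℝ) :
    fourier h ((x + y : ℝ) : UnitAddCircle) =
      fourier h (x : UnitAddCircle) * fourier h (y : UnitAddCircle) := by
  rw [fourier_unit_coe, fourier_unit_coe, fourier_unit_coe, ← Complex.exp_add]
  congr 1
  push_cast
  ring

theorem norm_fourier_sub_le (h : ℤ) (x y : ℝ) :
    ‖fourier h (x : UnitAddCircle) - fourier h (y : UnitAddCircle)‖
      ≤ 2 * Real.pi * |(h : ℝ)| * |x - y| := by
  have hx : x = y + (x - y) := by ring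
  rw [hx, fourier_unit_coe_add]
  calc ‖fourier h (y : UnitAddCircle) * fourier h ((x - y : ℝ) : UnitAddCircle)
          - fourier h (y : UnitAddCircle)‖
      = ‖fourier h (y : UnitAddCircle) * (fourier h ((x - y : ℝ) : UnitAddCircle) - 1)‖ := by
        congr 1; ring
    _ = ‖fourier h ((x - y : ℝ) : UnitAddCircle) - 1‖ := by
        rw [norm_mul, norm_fourier_apply, one_mul]
    _ ≤ ‖2 * Real.pi * h * (x - y)‖ := by
        rw [fourier_unit_coe]; exact Real.norm_exp_I_mul_ofReal_sub_one_le
    _ = 2 * Real.pi * |(h : ℝ)| * |y + (x - y) - y| := by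
        rw [Real.norm_eq_abs, abs_mul, abs_mul, abs_mul, abs_of_pos Real.pi_pos]
        norm_num

theorem coe_add_intCast (x : ℝ) (z : ℤ) : ((x + z : ℝ) : UnitAddCircle) = x := by
  have h1 : ((z : ℝ) : UnitAddCircle) = 0 := by
    rw [AddCircle.coe_eq_zero_iff]
    exact ⟨z, by simp⟩
  rw [AddCircle.coe_add, h1, add_zero]

theorem coe_centeredFract (x : ℝ) : ((centeredFract x : ℝ) : UnitAddCircle) = x := by
  have : x = centeredFract x + (⌊x + 1 / 2⌋ : ℤ) := by
    have := Int.fract_add_floor (x + 1 / 2)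
    unfold centeredFract
    linarith
  conv_rhs => rw [this]
  rw [coe_add_intCast]

theorem centeredFract_mem (x : ℝ) : centeredFract x ∈ Set.Ico (-(1 / 2) : ℝ) (-(1 / 2) + 1) := by
  unfold centeredFract
  have h1 := Int.fract_nonneg (x + 1 / 2)
  have h2 := Int.fract_lt_one (x + 1 / 2)
  constructor <;> linarith

/-- Weyl's condition is stable under perturbations that are small on average. -/
theorem WeylSums.of_perturbation {x y δ : ℕ → ℝ}
    (hy : ∀ n, (y n : UnitAddCircle) = ((x n + δ n : ℝ) : UnitAddCircle))
    (hδ : Tendsto (fun N : ℕ => (∑ n ∈ Finset.range N, |δ n|) / (N : ℝ)) atTop (𝓝 0))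
    (hx : WeylSums x) : WeylSums y := by
  intro h hh
  have key : Tendsto (fun N : ℕ => (∑ n ∈ Finset.range N, fourier h (y n : UnitAddCircle)) / (N : ℂ)
      - (∑ n ∈ Finset.range N, fourier h (x n : UnitAddCircle)) / (N : ℂ)) atTop (𝓝 0) := by
    have h1 := hδ.const_mul (2 * Real.pi * |(h : ℝ)|)
    rw [mul_zero] at h1
    refine squeeze_zero_norm (fun N => ?_) h1
    rw [← sub_div, ← Finset.sum_sub_distrib, norm_div, Complex.norm_natCast, ← mul_div_assoc]
    gcongr
    rw [Finset.mul_sum]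
    refine norm_sum_le_of_le _ fun n _ => ?_
    rw [hy]
    simpa using norm_fourier_sub_le h (x n + δ n) (x n)
  simpa using key.add (hx h hh)

/-- A geometric sum whose ratio is a K-th root of unity, different from 1 because K does not divide
h. -/
theorem sum_fourier_equidistant {h : ℤ} {K : ℕ} (hK : h.natAbs < K) (hh : h ≠ 0) :
    ∑ j ∈ Finset.range K, fourier h (((j : ℝ) / K - 1 / 2 : ℝ) : UnitAddCircle) = 0 := by
  have hK0 : (K : ℝ) ≠ 0 := by
    have : 0 < K := by omega
    positivity
  set w := fourier h ((1 / K : ℝ) : UnitAddCircle) with hw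
  have hpow : ∀ j : ℕ, fourier h (((j : ℝ) / K - 1 / 2 : ℝ) : UnitAddCircle)
      = fourier h ((-(1 / 2) : ℝ) : UnitAddCircle) * w ^ j := by
    intro j
    induction j with
    | zero => simp
    | succ j ih =>
      rw [pow_succ, ← mul_assoc, ← ih, hw, ← fourier_unit_coe_add]
      congr 2
      push_cast
      ring
  simp_rw [hpow]
  rw [← Finset.mul_sum]
  have hwK : w ^ K = 1 := by
    have h1 := hpow K
    rw [div_self hK0, show (1 - 1 / 2 : ℝ) = -(1 / 2) + (1 : ℝ) by norm_num,
      fourier_unit_coe_add] at h1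
    have h2 : fourier h ((1 : ℝ) : UnitAddCircle) = 1 := by
      have : ((1 : ℝ) : UnitAddCircle) = 0 := AddCircle.coe_period 1
      rw [this, fourier_eval_zero]
    rw [h2] at h1
    refine (mul_left_cancel₀ ?_ h1).symm
    rw [← norm_ne_zero_iff, norm_fourier_apply]
    exact one_ne_zero
  have hw1 : w ≠ 1 := by
    rw [hw, fourier_unit_coe, Ne, Complex.exp_eq_one_iff]
    rintro ⟨n, hn⟩
    have h3 : (2 * Real.pi * h * (1 / K) : ℝ) = n * (2 * Real.pi) := by
      have h4 := congrArg Complex.im hn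
      simpa using h4
    have h5 : (h : ℝ) = n * K := by
      have := Real.pi_pos
      field_simp at h3
      linarith
    have h6 : h = n * K := by exact_mod_cast h5
    have h7 : (K : ℤ) ∣ h := ⟨n, by rw [h6]; ring⟩
    have h8 := Int.natAbs_dvd_natAbs.mpr h7
    have h9 := Nat.le_of_dvd (Int.natAbs_pos.mpr hh) h8
    simp at h9
    omega
  rw [geom_sum_eq hw1, hwK]
  simp

/-- Cut the circle into K equal intervals and replace each term by the left endpoint t (q n) of its
interval. This costs at most 2π|h|/K, and the averages of the resulting step function tend to a
multiple of the vanishing sum in `sum_fourier_equidistant`. -/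
theorem UniformlyDistributedModOne.weylSums {x : ℕ → ℝ} (hx : UniformlyDistributedModOne x) :
    WeylSums x := by
  classical
  intro h hh
  rw [Metric.tendsto_atTop]
  intro ε hε
  obtain ⟨K, hK1, hK2⟩ : ∃ K : ℕ, h.natAbs < K ∧ 2 * Real.pi * |(h : ℝ)| / K < ε / 2 := by
    obtain ⟨K, hK⟩ := exists_nat_gt (max (h.natAbs : ℝ) (2 * Real.pi * |(h : ℝ)| / (ε / 2)))
    have h1 := (le_max_left _ _).trans_lt hK
    have h2 := (le_max_right _ _).trans_lt hK
    have h3 : h.natAbs < K := by exact_mod_cast h1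
    have h4 : (0 : ℝ) < K := by
      have : 0 < K := by omega
      exact_mod_cast this
    refine ⟨K, h3, ?_⟩
    rw [div_lt_iff₀ (by positivity)] at h2
    rw [div_lt_iff₀ h4]
    linarith
  have hKpos : (0 : ℝ) < K := by
    have : 0 < K := by omega
    exact_mod_cast this
  let q : ℕ → ℕ := fun n => ⌊(K : ℝ) * (centeredFract (x n) + 1 / 2)⌋₊
  let t : ℕ → ℝ := fun j => (j : ℝ) / K - 1 / 2
  let f : ℕ → ℂ := fun j => fourier h (t j : UnitAddCircle)
  have hnn : ∀ n, 0 ≤ (K : ℝ) * (centeredFract (x n) + 1 / 2) := fun n => by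
    have := (centeredFract_mem (x n)).1
    exact mul_nonneg hKpos.le (by linarith)
  have hq_lt : ∀ n, q n < K := fun n => by
    have h1 := (centeredFract_mem (x n)).2
    rw [Nat.floor_lt (hnn n)]
    nlinarith
  have hq_iff : ∀ n j, q n = j ↔ centeredFract (x n) ∈ Set.Ico (t j) (t (j + 1)) := fun n j => by
    simp only [q, t, Nat.floor_eq_iff (hnn n), Set.mem_Ico]
    push_cast
    rw [sub_le_iff_le_add, lt_sub_iff_add_lt, div_le_iff₀ hKpos, lt_div_iff₀ hKpos]
    constructor <;> rintro ⟨h1, h2⟩ <;> constructor <;> linarith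
  have hq_close : ∀ n, |centeredFract (x n) - t (q n)| ≤ 1 / K := fun n => by
    obtain ⟨h1, h2⟩ := (hq_iff n (q n)).mp rfl
    have h3 : t (q n + 1) = t (q n) + 1 / K := by simp only [t]; push_cast; ring
    rw [abs_of_nonneg (by linarith)]
    linarith
  have hmain : Tendsto (fun N : ℕ => ∑ j ∈ Finset.range K, f j *
      ((((Finset.range N).filter fun n => q n = j).card : ℝ) / (N : ℝ) : ℝ)) atTop (𝓝 0) := by
    have h0 : (0 : ℂ) = ∑ j ∈ Finset.range K, f j * ((1 / K : ℝ) : ℂ) := by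
      rw [← Finset.sum_mul, sum_fourier_equidistant hK1 hh, zero_mul]
    rw [h0]
    refine tendsto_finsetSum _ fun j hj => Tendsto.const_mul _ ?_
    refine (Complex.continuous_ofReal.tendsto _).comp ?_
    have hjK : ((j : ℝ) + 1) ≤ K := by exact_mod_cast Finset.mem_range.mp hj
    have h1 := hx (t j) (t (j + 1))
      (by have : (0 : ℝ) ≤ (j : ℝ) / K := by positivity
          simp only [t]; linarith)
      (by simp only [t]; push_cast; gcongr; linarith)
      (by have : ((j : ℝ) + 1) / K ≤ 1 := (div_le_one hKpos).mpr hjK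
          simp only [t]; push_cast; linarith)
    have h2 : t (j + 1) - t j = 1 / K := by simp only [t]; push_cast; ring
    rw [h2] at h1
    refine h1.congr fun N => ?_
    congr 3
    exact Finset.filter_congr fun n _ => (hq_iff n j).symm
  obtain ⟨N₀, hN₀⟩ := (Metric.tendsto_atTop.mp hmain) (ε / 2) (by positivity)
  refine ⟨N₀, fun N hN => ?_⟩
  have h1 := hN₀ N hN
  rw [dist_zero_right] at h1 ⊢
  have hsum : ∑ j ∈ Finset.range K, f j *
      ((((Finset.range N).filter fun n => q n = j).card : ℝ) / (N : ℝ) : ℝ)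
      = (∑ n ∈ Finset.range N, f (q n)) / (N : ℂ) := by
    rw [← Finset.sum_fiberwise_of_maps_to (s := Finset.range N) (t := Finset.range K) (g := q)
      (fun n _ => Finset.mem_range.mpr (hq_lt n)), Finset.sum_div]
    refine Finset.sum_congr rfl fun j _ => ?_
    rw [Finset.sum_congr rfl (g := fun _ => f j)
      (fun n hn => by rw [(Finset.mem_filter.mp hn).2]), Finset.sum_const, nsmul_eq_mul]
    push_cast
    ring
  have hdiff : ‖(∑ n ∈ Finset.range N, fourier h (x n : UnitAddCircle)) / (N : ℂ)
      - (∑ n ∈ Finset.range N, f (q n)) / (N : ℂ)‖ ≤ 2 * Real.pi * |(h : ℝ)| / K := by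
    rw [← sub_div, ← Finset.sum_sub_distrib, norm_div, Complex.norm_natCast]
    refine div_le_of_le_mul₀ (Nat.cast_nonneg _) (by positivity) ?_
    refine (norm_sum_le_of_le (n := fun _ => 2 * Real.pi * |(h : ℝ)| / K) _ fun n _ => ?_).trans ?_
    · rw [← coe_centeredFract (x n)]
      refine (norm_fourier_sub_le h _ _).trans ?_
      rw [div_eq_mul_one_div _ (K : ℝ)]
      gcongr
      exact hq_close n
    · rw [Finset.sum_const, Finset.card_range, nsmul_eq_mul, mul_comm]
  rw [hsum] at h1
  have h2 := norm_add_le ((∑ n ∈ Finset.range N, fourier h (x n : UnitAddCircle)) / (N : ℂ)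
      - (∑ n ∈ Finset.range N, f (q n)) / (N : ℂ)) ((∑ n ∈ Finset.range N, f (q n)) / (N : ℂ))
  rw [sub_add_cancel] at h2
  linarith

theorem integral_fourier_eq_zero {h : ℤ} (hh : h ≠ 0) :
    ∫ z : UnitAddCircle, fourier h z = 0 :=
  integral_eq_zero_of_add_right_eq_neg (fourier_add_half_inv_index hh one_pos)

/-- Holds for trigonometric polynomials by linearity, and passes to uniform limits. -/
theorem WeylSums.tendsto_average {x : ℕ → ℝ} (hx : WeylSums x) (f : C(UnitAddCircle, ℂ)) :
    Tendsto (fun N : ℕ => (∑ n ∈ Finset.range N, f (x n : UnitAddCircle)) / (N : ℂ)) atTop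
      (𝓝 (∫ z : UnitAddCircle, f z)) := by
  have hint : ∀ f : C(UnitAddCircle, ℂ), Integrable f (volume : Measure UnitAddCircle) := fun f =>
    f.continuous.integrable_of_hasCompactSupport (HasCompactSupport.of_compactSpace _)
  have hspan : ∀ g ∈ Submodule.span ℂ (Set.range (fourier (T := 1))),
      Tendsto (fun N : ℕ => (∑ n ∈ Finset.range N, g (x n : UnitAddCircle)) / (N : ℂ)) atTop
      (𝓝 (∫ z : UnitAddCircle, g z)) := by
    intro g hg
    induction hg using Submodule.span_induction with
    | mem g hg =>
      obtain ⟨h, rfl⟩ := hg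
      by_cases hh : h = 0
      · subst hh
        simp only [fourier_zero, Finset.sum_const, Finset.card_range, nsmul_eq_mul, mul_one,
          integral_const]
        have : (volume : Measure UnitAddCircle).real Set.univ = 1 := by
          simp [Measure.real]
        rw [this]
        refine tendsto_const_nhds.congr' ?_
        filter_upwards [eventually_gt_atTop 0] with N hN
        rw [div_self (by exact_mod_cast hN.ne')]
        simp
      · rw [integral_fourier_eq_zero hh]
        exact hx h hh
    | zero => simp
    | add g₁ g₂ _ _ h₁ h₂ =>
      simp only [ContinuousMap.add_apply]
      rw [integral_add (hint g₁) (hint g₂)]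
      refine (h₁.add h₂).congr fun N => ?_
      rw [Finset.sum_add_distrib, add_div]
    | smul c g _ h₁ =>
      simp only [ContinuousMap.smul_apply]
      rw [integral_smul]
      refine (h₁.const_smul c).congr fun N => ?_
      rw [← Finset.smul_sum, smul_eq_mul, smul_eq_mul, mul_div_assoc]
  rw [Metric.tendsto_atTop]
  intro ε hε
  have hf : f ∈ (Submodule.span ℂ (Set.range (fourier (T := 1)))).topologicalClosure := by
    rw [span_fourier_closure_eq_top]; trivial
  obtain ⟨g, hg, hfg⟩ := Metric.mem_closure_iff.mp hf (ε / 4) (by positivity)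
  obtain ⟨N₀, hN₀⟩ := Metric.tendsto_atTop.mp (hspan g hg) (ε / 4) (by positivity)
  refine ⟨N₀, fun N hN => ?_⟩
  have hpt : ∀ z, ‖f z - g z‖ ≤ ε / 4 := fun z => by
    rw [← dist_eq_norm]
    exact (ContinuousMap.dist_apply_le_dist z).trans hfg.le
  have h1 : dist ((∑ n ∈ Finset.range N, f (x n : UnitAddCircle)) / (N : ℂ))
      ((∑ n ∈ Finset.range N, g (x n : UnitAddCircle)) / (N : ℂ)) ≤ ε / 4 := by
    rw [dist_eq_norm, ← sub_div, ← Finset.sum_sub_distrib, norm_div, Complex.norm_natCast]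
    refine div_le_of_le_mul₀ (Nat.cast_nonneg _) (by positivity) ?_
    refine (norm_sum_le_of_le _ fun n _ => hpt _).trans ?_
    rw [Finset.sum_const, Finset.card_range, nsmul_eq_mul, mul_comm]
  have h2 : dist (∫ z : UnitAddCircle, g z) (∫ z : UnitAddCircle, f z) ≤ ε / 4 := by
    rw [dist_comm, dist_eq_norm, ← integral_sub (hint f) (hint g)]
    refine (norm_integral_le_of_norm_le_const (Eventually.of_forall hpt)).trans ?_
    simp [Measure.real]
  have h3 := dist_triangle4 ((∑ n ∈ Finset.range N, f (x n : UnitAddCircle)) / (N : ℂ))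
    ((∑ n ∈ Finset.range N, g (x n : UnitAddCircle)) / (N : ℂ)) (∫ z : UnitAddCircle, g z)
    (∫ z : UnitAddCircle, f z)
  linarith [hN₀ N hN]

/-- The uniform probability measure on the first `N + 1` points of the sequence modulo one. -/
noncomputable def empiricalMeasure (x : ℕ → ℝ) (N : ℕ) : Measure UnitAddCircle :=
  ((N + 1 : ℕ) : ENNReal)⁻¹ • ∑ n ∈ Finset.range (N + 1), Measure.dirac (x n : UnitAddCircle)

instance (x : ℕ → ℝ) (N : ℕ) : IsProbabilityMeasure (empiricalMeasure x N) := ⟨by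
  simp only [empiricalMeasure, Measure.smul_apply, Measure.finsetSum_apply, measure_univ,
    Finset.sum_const, Finset.card_range, smul_eq_mul, nsmul_eq_mul, mul_one]
  exact ENNReal.inv_mul_cancel (by simp) (ENNReal.natCast_ne_top _)⟩

theorem integral_empiricalMeasure (x : ℕ → ℝ) (N : ℕ) (f : C(UnitAddCircle, ℂ)) :
    ∫ z, f z ∂empiricalMeasure x N =
      (∑ n ∈ Finset.range (N + 1), f (x n : UnitAddCircle)) / ((N + 1 : ℕ) : ℂ) := by
  rw [empiricalMeasure, integral_smul_measure, integral_finsetSum_measure]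
  · simp only [integral_dirac, ENNReal.toReal_inv, ENNReal.toReal_natCast, div_eq_inv_mul]
    rw [Complex.real_smul, Complex.ofReal_inv, Complex.ofReal_natCast]
  · exact fun n _ => f.continuous.integrable_of_hasCompactSupport
      (HasCompactSupport.of_compactSpace _)

/-- The image in the circle of a half-open interval. -/
def arc (a b : ℝ) : Set UnitAddCircle := (fun x : ℝ => (x : UnitAddCircle)) '' Set.Ico a b

theorem coe_mem_arc_iff {a b : ℝ} (ha : -(1 / 2) ≤ a) (hb : b ≤ 1 / 2) {x : ℝ} :
    (x : UnitAddCircle) ∈ arc a b ↔ centeredFract x ∈ Set.Ico a b := by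
  constructor
  · rintro ⟨y, hy, hyx⟩
    have h1 : y ∈ Set.Ico (-(1 / 2) : ℝ) (-(1 / 2) + 1) :=
      ⟨ha.trans hy.1, by have := hy.2; linarith⟩
    have h2 : (y : UnitAddCircle) = (centeredFract x : ℝ) := by rw [coe_centeredFract]; exact hyx
    have h3 := (AddCircle.coe_eq_coe_iff_of_mem_Ico h1 (centeredFract_mem x)).mp h2
    rwa [← h3]
  · exact fun h => ⟨_, h, coe_centeredFract x⟩

theorem frontier_arc_subset (a b : ℝ) :
    frontier (arc a b) ⊆ {(a : UnitAddCircle), (b : UnitAddCircle)} := by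
  have hc : closure (arc a b) ⊆ (fun x : ℝ => (x : UnitAddCircle)) '' Set.Icc a b :=
    closure_minimal (Set.image_mono Set.Ico_subset_Icc_self)
      (isCompact_Icc.image (AddCircle.continuous_mk' 1)).isClosed
  have hi : (fun x : ℝ => (x : UnitAddCircle)) '' Set.Ioo a b ⊆ interior (arc a b) :=
    interior_maximal (Set.image_mono Set.Ioo_subset_Ico_self)
      (QuotientAddGroup.isOpenMap_coe _ isOpen_Ioo)
  rintro z ⟨hz1, hz2⟩
  obtain ⟨y, ⟨hy1, hy2⟩, rfl⟩ := hc hz1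
  rcases hy1.eq_or_lt with rfl | h1
  · exact Or.inl rfl
  rcases hy2.eq_or_lt with rfl | h2
  · exact Or.inr rfl
  exact absurd (hi ⟨y, ⟨h1, h2⟩, rfl⟩) hz2

theorem volume_singleton_circle (z : UnitAddCircle) : volume ({z} : Set UnitAddCircle) = 0 := by
  rw [← Metric.closedBall_zero, AddCircle.volume_closedBall]
  simp

theorem volume_frontier_arc (a b : ℝ) : volume (frontier (arc a b)) = 0 := by
  refine measure_mono_null (frontier_arc_subset a b) ?_
  rw [Set.insert_eq, measure_union_null_iff]
  exact ⟨volume_singleton_circle _, volume_singleton_circle _⟩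

theorem measurableSet_arc (a b : ℝ) : MeasurableSet (arc a b) := by
  have h : arc a b = (fun x : ℝ => (x : UnitAddCircle)) '' Set.Ioo a b ∪
      arc a b \ (fun x : ℝ => (x : UnitAddCircle)) '' Set.Ioo a b :=
    (Set.union_sdiff_cancel (Set.image_mono Set.Ioo_subset_Ico_self)).symm
  rw [h]
  refine (QuotientAddGroup.isOpenMap_coe _ isOpen_Ioo).measurableSet.union ?_
  refine (Set.Finite.subset (Set.finite_singleton (a : UnitAddCircle)) ?_).measurableSet
  rintro z ⟨⟨y, ⟨hy1, hy2⟩, rfl⟩, hz⟩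
  rcases hy1.eq_or_lt with rfl | h1
  · rfl
  · exact absurd ⟨y, ⟨h1, hy2⟩, rfl⟩ hz

theorem volume_arc {a b : ℝ} (ha : -(1 / 2) ≤ a) (hb : b ≤ 1 / 2) :
    volume (arc a b) = ENNReal.ofReal (b - a) := by
  rw [AddCircle.add_projection_respects_measure 1 (-(1 / 2)) (measurableSet_arc a b)]
  refine le_antisymm ?_ ?_
  -- The fundamental domain is open on the left, while `centeredFract` uses the one open on the
  -- right; the discrepancy is the null set {1/2}.
  · calc volume ((QuotientAddGroup.mk ⁻¹' arc a b : Set ℝ) ∩ Set.Ioc (-(1 / 2)) (-(1 / 2) + 1))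
        ≤ volume (Set.Ico a b ∪ {1 / 2}) := by
          refine measure_mono ?_
          rintro y ⟨hy1, hy2, hy3⟩
          rcases eq_or_lt_of_le hy3 with h | h
          · exact Or.inr (by rw [h]; norm_num)
          · left
            have h1 := (coe_mem_arc_iff ha hb).mp hy1
            have h2 := (AddCircle.coe_eq_coe_iff_of_mem_Ico (p := 1) (centeredFract_mem y)
              ⟨hy2.le, h⟩).mp (coe_centeredFract y)
            rwa [h2] at h1
      _ ≤ volume (Set.Ico a b) + volume ({1 / 2} : Set ℝ) := measure_union_le _ _
      _ = ENNReal.ofReal (b - a) := by simp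
  · rw [← Real.volume_Ioo]
    refine measure_mono fun y hy => ⟨⟨y, Set.Ioo_subset_Ico_self hy, rfl⟩, ?_, ?_⟩
    · linarith [hy.1]
    · linarith [hy.2]

theorem empiricalMeasure_arc {a b : ℝ} (ha : -(1 / 2) ≤ a) (hb : b ≤ 1 / 2)
    (x : ℕ → ℝ) (N : ℕ) [DecidablePred fun n => centeredFract (x n) ∈ Set.Ico a b] :
    (empiricalMeasure x N).real (arc a b) =
      (((Finset.range (N + 1)).filter fun n => centeredFract (x n) ∈ Set.Ico a b).card : ℝ) /
        ((N + 1 : ℕ) : ℝ) := by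
  simp only [Measure.real, empiricalMeasure, Measure.smul_apply, Measure.finsetSum_apply,
    Measure.dirac_apply' _ (measurableSet_arc a b), smul_eq_mul, ENNReal.toReal_mul]
  rw [ENNReal.toReal_sum (fun n _ => by
    by_cases h : (x n : UnitAddCircle) ∈ arc a b <;> simp [h])]
  rw [Finset.card_filter, div_eq_inv_mul]
  rw [ENNReal.toReal_inv, ENNReal.toReal_natCast, Nat.cast_sum]
  congr 1
  refine Finset.sum_congr rfl fun n _ => ?_
  by_cases h : centeredFract (x n) ∈ Set.Ico a b
  · rw [if_pos h, Set.indicator_of_mem ((coe_mem_arc_iff ha hb).mpr h)]; simp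
  · rw [if_neg h, Set.indicator_of_notMem (mt (coe_mem_arc_iff ha hb).mp h)]; simp

/-- The empirical measures converge weakly to Haar measure. Arcs have null boundary, so the
portmanteau theorem gives convergence of their frequencies. -/
theorem WeylSums.uniformlyDistributedModOne {x : ℕ → ℝ} (hx : WeylSums x) :
    UniformlyDistributedModOne x := by
  intro a b ha hab hb
  let μ : ℕ → ProbabilityMeasure UnitAddCircle := fun N => ⟨empiricalMeasure x N, inferInstance⟩
  let ν : ProbabilityMeasure UnitAddCircle := ⟨volume, ⟨UnitAddCircle.measure_univ⟩⟩
  have hlim : Tendsto μ atTop (𝓝 ν) := by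
    rw [ProbabilityMeasure.tendsto_iff_forall_integral_rclike_tendsto ℂ]
    intro f
    have h1 := (hx.tendsto_average f.toContinuousMap).comp (tendsto_add_atTop_nat 1)
    exact h1.congr fun N => (integral_empiricalMeasure x N f.toContinuousMap).symm
  have h2 := ProbabilityMeasure.tendsto_measure_of_null_frontier_of_tendsto' hlim
    (E := arc a b) (volume_frontier_arc a b)
  have h3 : Tendsto (fun N => (empiricalMeasure x N).real (arc a b)) atTop (𝓝 (b - a)) := by
    have h4 := (ENNReal.tendsto_toReal (measure_ne_top (ν : Measure UnitAddCircle) (arc a b))).comp h2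
    have h5 : ((ν : Measure UnitAddCircle) (arc a b)).toReal = b - a := by
      change (volume (arc a b)).toReal = b - a
      rw [volume_arc ha hb, ENNReal.toReal_ofReal (by linarith)]
    rw [h5] at h4
    exact h4
  rw [← tendsto_add_atTop_iff_nat 1]
  refine h3.congr fun N => ?_
  classical
  rw [empiricalMeasure_arc ha hb]

theorem uniformlyDistributedModOne_iff_weylSums {x : ℕ → ℝ} :
    UniformlyDistributedModOne x ↔ WeylSums x :=
  ⟨UniformlyDistributedModOne.weylSums, WeylSums.uniformlyDistributedModOne⟩

end RecurrenceNormal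

/-! ### A strong law of large numbers and the metric theorem. -/

namespace RecurrenceNormal

open MeasureTheory

/-- Each N exceeds the square of k = ⌊√N⌋ by at most 2k, so passing from N to that square changes
the average by O(1/k). -/
theorem norm_sub_square_div_le {S : ℕ → ℂ} (hS : ∀ m n, m ≤ n → ‖S n - S m‖ ≤ (n : ℝ) - m)
    (h : Tendsto (fun k : ℕ => S ((k + 1) ^ 2) / (((k + 1) ^ 2 : ℕ) : ℂ)) atTop (𝓝 0)) :
    Tendsto (fun N : ℕ => S N / (N : ℂ)) atTop (𝓝 0) := by
  have h' : Tendsto (fun k : ℕ => ‖S (k ^ 2) / ((k ^ 2 : ℕ) : ℂ)‖ + 2 / (k : ℝ)) atTop (𝓝 0) := by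
    have h1 := (tendsto_add_atTop_iff_nat (f := fun k : ℕ => S (k ^ 2) / ((k ^ 2 : ℕ) : ℂ)) 1).mp h
    simpa using h1.norm.add (tendsto_const_div_atTop_nhds_zero_nat (2 : ℝ))
  have hsqrt : Tendsto Nat.sqrt atTop atTop := by
    refine tendsto_atTop.mpr fun b => ?_
    filter_upwards [eventually_ge_atTop (b * b)] with n hn
    exact Nat.le_sqrt.mpr hn
  refine squeeze_zero_norm' ?_ (h'.comp hsqrt)
  filter_upwards [eventually_gt_atTop 0] with N hN
  have hk : 0 < N.sqrt := Nat.sqrt_pos.mpr hN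
  have hk1 : N.sqrt ^ 2 ≤ N := Nat.sqrt_le' N
  have hk2 : N ≤ N.sqrt ^ 2 + 2 * N.sqrt := by
    have := Nat.sqrt_le_add N
    nlinarith
  simp only [Function.comp_apply]
  generalize N.sqrt = k at *
  have h1 : ‖S N‖ ≤ ‖S (k ^ 2)‖ + 2 * k := by
    have h2 := hS _ _ hk1
    have h3 := norm_sub_norm_le (S N) (S (k ^ 2))
    have h4 : (N : ℝ) ≤ k ^ 2 + 2 * k := by exact_mod_cast hk2
    push_cast at h2
    linarith
  have hkpos : (0 : ℝ) < k := by exact_mod_cast hk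
  have hNk : ((k : ℝ)) ^ 2 ≤ N := by exact_mod_cast hk1
  rw [norm_div, norm_div, Complex.norm_natCast, Complex.norm_natCast]
  calc ‖S N‖ / (N : ℝ) ≤ (‖S (k ^ 2)‖ + 2 * k) / (k : ℝ) ^ 2 := by
        gcongr
    _ = ‖S (k ^ 2)‖ / ((k ^ 2 : ℕ) : ℝ) + 2 / (k : ℝ) := by
        push_cast
        field_simp

/-- A strong law of large numbers: bounded random variables whose correlations are summable
have averages tending to zero almost surely. -/
theorem ae_tendsto_average_zero {Ω : Type*} [MeasurableSpace Ω] {μ : Measure Ω}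
    [IsProbabilityMeasure μ] {X : ℕ → Ω → ℂ} (hX : ∀ n, Measurable (X n))
    (hX1 : ∀ n ω, ‖X n ω‖ ≤ 1) {C : ℝ}
    (hC : ∀ N : ℕ, ∑ n ∈ Finset.range N, ∑ m ∈ Finset.range N,
      ‖∫ ω, X n ω * (starRingEnd ℂ) (X m ω) ∂μ‖ ≤ C * N) :
    ∀ᵐ ω ∂μ, Tendsto (fun N : ℕ => (∑ n ∈ Finset.range N, X n ω) / (N : ℂ)) atTop (𝓝 0) := by
  let S : ℕ → Ω → ℂ := fun N ω => ∑ n ∈ Finset.range N, X n ω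
  have hSm : ∀ N, Measurable (S N) := fun N => Finset.measurable_fun_sum _ fun n _ => hX n
  have hSb : ∀ N ω, ‖S N ω‖ ≤ N := fun N ω => by
    refine (norm_sum_le_of_le _ fun n _ => hX1 n ω).trans ?_
    simp
  have hint : ∀ n m, Integrable (fun ω => X n ω * (starRingEnd ℂ) (X m ω)) μ := fun n m => by
    refine Integrable.of_bound ((hX n).mul (Complex.continuous_conj.measurable.comp
      (hX m))).aestronglyMeasurable 1 (Eventually.of_forall fun ω => ?_)
    rw [norm_mul, RCLike.norm_conj]
    exact mul_le_one₀ (hX1 n ω) (norm_nonneg _) (hX1 m ω)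
  have hsq : ∀ N, ∫ ω, ‖S N ω‖ ^ 2 ∂μ ≤ C * N := fun N => by
    have h1 : ((∫ ω, ‖S N ω‖ ^ 2 ∂μ : ℝ) : ℂ) = ∑ n ∈ Finset.range N, ∑ m ∈ Finset.range N,
        ∫ ω, X n ω * (starRingEnd ℂ) (X m ω) ∂μ := by
      rw [← integral_complex_ofReal]
      simp_rw [← integral_finsetSum (Finset.range N) fun m _ => hint _ m]
      rw [← integral_finsetSum _ fun n _ => integrable_finsetSum _ fun m _ => hint n m]
      refine integral_congr_ae (Eventually.of_forall fun ω => ?_)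
      simp only [Complex.ofReal_pow]
      rw [← Complex.mul_conj', map_sum, Finset.sum_mul_sum]
    have h2 : 0 ≤ ∫ ω, ‖S N ω‖ ^ 2 ∂μ := integral_nonneg fun _ => by positivity
    calc ∫ ω, ‖S N ω‖ ^ 2 ∂μ = ‖((∫ ω, ‖S N ω‖ ^ 2 ∂μ : ℝ) : ℂ)‖ := by
          rw [Complex.norm_real, Real.norm_of_nonneg h2]
      _ ≤ _ := by
          rw [h1]
          exact (norm_sum_le_of_le _ fun n _ => norm_sum_le _ _).trans (hC N)
  -- Along the squares the second moments of the averages are at most C/(k+1)², hence summable, so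
  -- the sum of f is finite almost everywhere.
  let f : ℕ → Ω → ENNReal := fun k ω =>
    ENNReal.ofReal (‖S ((k + 1) ^ 2) ω / (((k + 1) ^ 2 : ℕ) : ℂ)‖ ^ 2)
  have hfm : ∀ k, Measurable (f k) := fun k =>
    (((hSm _).div_const _).norm.pow_const 2).ennreal_ofReal
  have hfi : ∀ k, ∫⁻ ω, f k ω ∂μ ≤ ENNReal.ofReal (C * (1 / ((k + 1 : ℕ) : ℝ) ^ 2)) := fun k => by
    rw [← ofReal_integral_eq_lintegral_ofReal]
    · refine ENNReal.ofReal_le_ofReal ?_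
      have hk : (0 : ℝ) < (k : ℝ) + 1 := by positivity
      have h1 : ∀ ω, ‖S ((k + 1) ^ 2) ω / (((k + 1) ^ 2 : ℕ) : ℂ)‖ ^ 2 =
          (1 / ((k : ℝ) + 1) ^ 4) * ‖S ((k + 1) ^ 2) ω‖ ^ 2 := fun ω => by
        rw [norm_div, Complex.norm_natCast]
        push_cast
        field_simp
      simp_rw [h1]
      rw [integral_const_mul]
      calc (1 / ((k : ℝ) + 1) ^ 4) * ∫ ω, ‖S ((k + 1) ^ 2) ω‖ ^ 2 ∂μ
          ≤ (1 / ((k : ℝ) + 1) ^ 4) * (C * ((k + 1) ^ 2 : ℕ)) := by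
            gcongr
            exact hsq _
        _ = _ := by push_cast; field_simp
    · refine Integrable.of_bound (((hSm _).div_const _).norm.pow_const 2).aestronglyMeasurable 1
        (Eventually.of_forall fun ω => ?_)
      rw [Real.norm_of_nonneg (by positivity), norm_div, Complex.norm_natCast]
      refine pow_le_one₀ (by positivity) (div_le_one_of_le₀ (hSb _ ω) (by positivity))
    · exact Eventually.of_forall fun _ => by positivity
  have hsum : ∫⁻ ω, ∑' k, f k ω ∂μ ≠ ⊤ := by
    rw [lintegral_tsum fun k => (hfm k).aemeasurable]
    have h1 : Summable fun k : ℕ => C * (1 / ((k + 1 : ℕ) : ℝ) ^ 2) :=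
      ((summable_nat_add_iff 1).mpr (Real.summable_one_div_nat_pow.mpr one_lt_two)).mul_left C
    exact ne_top_of_le_ne_top h1.tsum_ofReal_ne_top (ENNReal.tsum_le_tsum hfi)
  filter_upwards [ae_lt_top (Measurable.tsum hfm) hsum] with ω hω
  refine norm_sub_square_div_le (S := fun N => S N ω) (fun m n hmn => ?_) ?_
  · simp only [S]
    rw [← Finset.sum_range_add_sum_Ico _ hmn, add_sub_cancel_left]
    refine (norm_sum_le_of_le _ fun n _ => hX1 n ω).trans ?_
    simp [Nat.cast_sub hmn]
  · have h1 := ENNReal.tendsto_atTop_zero_of_tsum_ne_top hω.ne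
    have h2 := (ENNReal.tendsto_toReal ENNReal.zero_ne_top).comp h1
    have h3 : Tendsto (fun k : ℕ => ‖S ((k + 1) ^ 2) ω / (((k + 1) ^ 2 : ℕ) : ℂ)‖ ^ 2)
        atTop (𝓝 0) := by
      refine h2.congr fun k => ?_
      simp only [Function.comp_apply, f]
      exact ENNReal.toReal_ofReal (by positivity)
    rw [tendsto_zero_iff_norm_tendsto_zero]
    have h4 := h3.sqrt
    rw [Real.sqrt_zero] at h4
    exact h4.congr fun k => Real.sqrt_sq (norm_nonneg _)

theorem norm_integral_exp_le (y : ℝ) :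
    ‖∫ s in Set.Ioc (0 : ℝ) 1, Complex.exp (Complex.I * ((y * s : ℝ) : ℂ))‖ ≤ 1 := by
  refine (norm_setIntegral_le_of_norm_le_const (C := 1) (by simp) fun s _ => ?_).trans (by simp)
  rw [mul_comm, Complex.norm_exp_ofReal_mul_I]

theorem abs_mul_norm_integral_exp_le (y : ℝ) :
    |y| * ‖∫ s in Set.Ioc (0 : ℝ) 1, Complex.exp (Complex.I * ((y * s : ℝ) : ℂ))‖ ≤ 2 := by
  by_cases hy : y = 0
  · simp [hy]
  rw [← intervalIntegral.integral_of_le zero_le_one]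
  have hc : Complex.I * (y : ℂ) ≠ 0 := by simp [hy]
  have h1 : ∀ s : ℝ, Complex.exp (Complex.I * ((y * s : ℝ) : ℂ))
      = Complex.exp (Complex.I * (y : ℂ) * s) := fun s => by push_cast; ring_nf
  simp_rw [h1]
  rw [integral_exp_mul_complex hc, norm_div]
  have h2 : ‖Complex.I * (y : ℂ)‖ = |y| := by simp
  rw [h2, mul_div_cancel₀ _ (abs_ne_zero.mpr hy)]
  refine (norm_sub_le _ _).trans ?_
  have h3 : ‖Complex.exp (Complex.I * (y : ℂ) * ((1 : ℝ) : ℂ))‖ = 1 := by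
    rw [Complex.ofReal_one, mul_one, mul_comm, Complex.norm_exp_ofReal_mul_I]
  rw [h3]
  norm_num

/-- Bounding by the power m alone, whichever exponent is larger, lets the correlations be summed
over m uniformly in n. -/
theorem le_norm_pow_sub_pow {α : ℂ} (hα : 1 < ‖α‖) {n m : ℕ} (hnm : n ≠ m) :
    (1 - ‖α‖⁻¹) * ‖α‖ ^ m ≤ ‖α ^ n - α ^ m‖ := by
  set r := ‖α‖ with hr
  have hr0 : 0 < r := by linarith
  have hinv : r * r⁻¹ = 1 := mul_inv_cancel₀ hr0.ne'
  have hinv1 : r⁻¹ < 1 := inv_lt_one_of_one_lt₀ hα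
  rcases lt_or_gt_of_ne hnm with h | h
  · obtain ⟨j, rfl⟩ := Nat.exists_eq_add_of_lt h
    have h1 := norm_sub_norm_le (α ^ (n + j + 1)) (α ^ n)
    rw [norm_sub_rev, norm_pow, norm_pow, ← hr] at h1
    have h2 : r ^ n ≤ r ^ (n + j) := pow_le_pow_right₀ hα.le (by omega)
    calc (1 - r⁻¹) * r ^ (n + j + 1) = r ^ (n + j + 1) - r ^ (n + j) := by
          rw [pow_succ]; linear_combination (-r ^ (n + j)) * hinv
      _ ≤ _ := by linarith
  · have h1 := norm_sub_norm_le (α ^ n) (α ^ m)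
    rw [norm_pow, norm_pow, ← hr] at h1
    have h2 : r ^ (m + 1) ≤ r ^ n := pow_le_pow_right₀ hα.le h
    have h3 : 0 < r ^ m := by positivity
    rw [pow_succ] at h2
    have h4 : (1 - r⁻¹) ≤ r - 1 := by nlinarith
    nlinarith

/-- The metric theorem: for `|α| > 1`, some (in fact almost every) complex number `a` gives a
sequence `Re (a α ^ n)` satisfying Weyl's condition. -/
theorem exists_weylSums_re_mul_pow {α : ℂ} (hα : 1 < ‖α‖) :
    ∃ a : ℂ, WeylSums fun n => (a * α ^ n).re := by
  let ν : Measure ℝ := volume.restrict (Set.Ioc (0 : ℝ) 1)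
  have : IsProbabilityMeasure ν := ⟨by simp [ν]⟩
  let μ : Measure (ℝ × ℝ) := ν.prod ν
  -- The sign makes Re (A p * w) the scalar product of p with (Re w, Im w), so the correlations
  -- factor by Fubini.
  let A : ℝ × ℝ → ℂ := fun p => ⟨p.1, -p.2⟩
  have hre : ∀ p n, (A p * α ^ n).re = p.1 * (α ^ n).re + p.2 * (α ^ n).im := fun p n => by
    simp [A, Complex.mul_re]
  have key : ∀ h : ℤ, h ≠ 0 → ∀ᵐ p ∂μ, Tendsto (fun N : ℕ =>
      (∑ n ∈ Finset.range N, fourier h ((A p * α ^ n).re : UnitAddCircle)) / (N : ℂ))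
        atTop (𝓝 0) := by
    intro h hh
    have hr0 : 0 < ‖α‖ := by linarith
    set q := ‖α‖⁻¹ with hq
    have hq0 : 0 < q := inv_pos.mpr hr0
    have hq1 : q < 1 := inv_lt_one_of_one_lt₀ hα
    have hq1' : 0 < 1 - q := by linarith
    let E : ℝ → ℂ := fun y => ∫ s in Set.Ioc (0 : ℝ) 1, Complex.exp (Complex.I * ((y * s : ℝ) : ℂ))
    have hcorr : ∀ n m, ∫ p, fourier h ((A p * α ^ n).re : UnitAddCircle) *
        (starRingEnd ℂ) (fourier h ((A p * α ^ m).re : UnitAddCircle)) ∂μ =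
        E (2 * Real.pi * h * (α ^ n - α ^ m).re) * E (2 * Real.pi * h * (α ^ n - α ^ m).im) := by
      intro n m
      simp only [E]
      rw [← integral_prod_mul (μ := ν) (ν := ν)]
      refine integral_congr_ae (Eventually.of_forall fun p => ?_)
      simp only
      rw [hre, hre, fourier_unit_coe, fourier_unit_coe, ← Complex.exp_conj, ← Complex.exp_add,
        ← Complex.exp_add]
      congr 1
      simp only [map_mul, Complex.conj_I, Complex.conj_ofReal, Complex.sub_re, Complex.sub_im]
      push_cast
      ring
    have hbound : ∀ n m, ‖∫ p, fourier h ((A p * α ^ n).re : UnitAddCircle) *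
        (starRingEnd ℂ) (fourier h ((A p * α ^ m).re : UnitAddCircle)) ∂μ‖ ≤
        (if n = m then 1 else 0) + 4 / (1 - q) * q ^ m := by
      intro n m
      rw [hcorr, norm_mul]
      split_ifs with hnm
      · have h1 := mul_le_one₀ (norm_integral_exp_le (2 * Real.pi * h * (α ^ n - α ^ m).re))
          (norm_nonneg _) (norm_integral_exp_le (2 * Real.pi * h * (α ^ n - α ^ m).im))
        have h2 : 0 ≤ 4 / (1 - q) * q ^ m := by positivity
        exact h1.trans (by linarith)
      · rw [zero_add]
        have h1 := le_norm_pow_sub_pow hα hnm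
        have h2 := Complex.norm_le_abs_re_add_abs_im (α ^ n - α ^ m)
        generalize α ^ n - α ^ m = w at h1 h2
        have hx := abs_mul_norm_integral_exp_le (2 * Real.pi * h * w.re)
        have hy := abs_mul_norm_integral_exp_le (2 * Real.pi * h * w.im)
        have hx1 := norm_integral_exp_le (2 * Real.pi * h * w.re)
        have hy1 := norm_integral_exp_le (2 * Real.pi * h * w.im)
        have hh1 : 1 ≤ |2 * Real.pi * (h : ℝ)| := by
          have h3 : (1 : ℝ) ≤ |(h : ℝ)| := by exact_mod_cast Int.one_le_abs hh
          have h4 := Real.pi_gt_three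
          rw [abs_mul, abs_of_pos (by positivity : (0 : ℝ) < 2 * Real.pi)]
          nlinarith
        have hw1 : |w.re| ≤ |2 * Real.pi * h * w.re| := by
          rw [abs_mul]; exact le_mul_of_one_le_left (abs_nonneg _) hh1
        have hw2 : |w.im| ≤ |2 * Real.pi * h * w.im| := by
          rw [abs_mul]; exact le_mul_of_one_le_left (abs_nonneg _) hh1
        change ‖E _‖ * ‖E _‖ ≤ _
        change _ * ‖E _‖ ≤ _ at hx
        change _ * ‖E _‖ ≤ _ at hy
        change ‖E _‖ ≤ _ at hx1
        change ‖E _‖ ≤ _ at hy1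
        have ha0 := norm_nonneg (E (2 * Real.pi * h * w.re))
        have hb0 := norm_nonneg (E (2 * Real.pi * h * w.im))
        generalize ‖E (2 * Real.pi * h * w.re)‖ = a at *
        generalize ‖E (2 * Real.pi * h * w.im)‖ = b at *
        have h5 : |w.re| * a ≤ 2 := (mul_le_mul_of_nonneg_right hw1 ha0).trans hx
        have h6 : |w.im| * b ≤ 2 := (mul_le_mul_of_nonneg_right hw2 hb0).trans hy
        -- The direction of w is unknown, so |w| is split as |Re w| + |Im w|; each summand is
        -- absorbed by its own factor, the other factor being at most 1.
        have h7 : (1 - q) * ‖α‖ ^ m * (a * b) ≤ 4 := by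
          calc (1 - q) * ‖α‖ ^ m * (a * b) ≤ (|w.re| + |w.im|) * (a * b) := by
                gcongr; exact h1.trans h2
            _ = (|w.re| * a) * b + (|w.im| * b) * a := by ring
            _ ≤ 2 * 1 + 2 * 1 := by gcongr
            _ = 4 := by norm_num
        rw [hq, inv_pow, ← hq, ← div_eq_mul_inv, div_div, le_div_iff₀ (by positivity)]
        linarith
    have hmeas : ∀ n, Measurable fun p : ℝ × ℝ =>
        fourier h ((A p * α ^ n).re : UnitAddCircle) := fun n => by
      simp_rw [hre, fourier_unit_coe]
      fun_prop
    refine ae_tendsto_average_zero (μ := μ) hmeas (fun n p => (norm_fourier_apply _ _).le)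
      (C := 1 + 4 / (1 - q) * (1 - q)⁻¹) fun N => ?_
    rw [mul_comm]
    have hrow : ∀ n ∈ Finset.range N, ∑ m ∈ Finset.range N,
        ‖∫ p, fourier h ((A p * α ^ n).re : UnitAddCircle) *
          (starRingEnd ℂ) (fourier h ((A p * α ^ m).re : UnitAddCircle)) ∂μ‖ ≤
        1 + 4 / (1 - q) * (1 - q)⁻¹ := fun n hn => by
      refine (Finset.sum_le_sum fun m _ => hbound n m).trans ?_
      rw [Finset.sum_add_distrib, Finset.sum_ite_eq, if_pos hn, ← Finset.mul_sum]
      gcongr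
      rw [← tsum_geometric_of_lt_one hq0.le hq1]
      exact (summable_geometric_of_lt_one hq0.le hq1).sum_le_tsum _ fun _ _ => by positivity
    refine (Finset.sum_le_sum hrow).trans ?_
    rw [Finset.sum_const, Finset.card_range, nsmul_eq_mul]
  have hall : ∀ᵐ p ∂μ, ∀ h : ℤ, h ≠ 0 → Tendsto (fun N : ℕ =>
      (∑ n ∈ Finset.range N, fourier h ((A p * α ^ n).re : UnitAddCircle)) / (N : ℂ))
        atTop (𝓝 0) :=
    ae_all_iff.mpr fun h => by
      by_cases hh : h = 0
      · exact Eventually.of_forall fun _ h0 => absurd hh h0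
      · filter_upwards [key h hh] with p hp _ using hp
  obtain ⟨p, hp⟩ := hall.exists
  exact ⟨A p, hp⟩

end RecurrenceNormal

namespace RecurrenceNormal

/-! ### The two-sided inverse of the recurrence operator. -/

section Kernel

open Classical in
/-- The set of complex roots of `P`. -/
noncomputable def complexRoots (P : ℤ[X]) : Finset ℂ := (P.aroots ℂ).toFinset

/-- The weights of the partial fraction decomposition of the reciprocal of `P`. -/
noncomputable def rootWeight (P : ℤ[X]) (α : ℂ) : ℂ :=
  (∏ β ∈ (complexRoots P).erase α, (α - β))⁻¹

/-- The impulse response of the recurrence with companion polynomial `P`. -/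
noncomputable def impulse (P : ℤ[X]) (i : ℕ) : ℂ :=
  ∑ α ∈ complexRoots P, rootWeight P α * α ^ i

/-- The part of the two-sided impulse response that is supported on the expanding roots. -/
noncomputable def expandingPart (P : ℤ[X]) (l : ℤ) : ℂ :=
  ∑ α ∈ expandingRoots P, rootWeight P α * α ^ (l - 1)

/-- The impulse response, extended by zero and shifted. -/
noncomputable def causalPart (P : ℤ[X]) (l : ℤ) : ℂ :=
  if 1 ≤ l then impulse P (l - 1).toNat else 0

/-- The summable two-sided inverse of the recurrence operator of `P`. -/
noncomputable def kernel (P : ℤ[X]) (l : ℤ) : ℝ :=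
  (causalPart P l).re - (expandingPart P l).re

variable {P : ℤ[X]}

theorem expandingRoots_subset : expandingRoots P ⊆ complexRoots P := by
  unfold expandingRoots complexRoots
  exact Finset.filter_subset _ _

theorem mem_expandingRoots_iff {α : ℂ} : α ∈ expandingRoots P ↔ α ∈ complexRoots P ∧ 1 < ‖α‖ := by
  unfold expandingRoots complexRoots
  exact Finset.mem_filter

theorem aeval_eq_zero_of_mem_complexRoots {α : ℂ} (h : α ∈ complexRoots P) : aeval α P = 0 := by
  classical
  simp only [complexRoots, Multiset.mem_toFinset, mem_aroots] at h
  exact h.2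

theorem one_lt_norm_of_mem_expandingRoots {α : ℂ} (h : α ∈ expandingRoots P) : 1 < ‖α‖ :=
  (mem_expandingRoots_iff.mp h).2

theorem card_complexRoots (hmonic : P.Monic) (hroots : (P.aroots ℂ).Nodup) :
    (complexRoots P).card = P.natDegree := by
  classical
  rw [complexRoots, Multiset.toFinset_card_of_nodup hroots, aroots,
    IsAlgClosed.card_roots_eq_natDegree, hmonic.natDegree_map]

theorem sum_coeff_mul_pow {α : ℂ} (h : α ∈ complexRoots P) :
    ∑ j ∈ Finset.range (P.natDegree + 1), (P.coeff j : ℂ) * α ^ j = 0 := by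
  have := aeval_eq_zero_of_mem_complexRoots h
  rw [aeval_eq_sum_range] at this
  simpa using this

/-- Lagrange interpolation of X ^ i at the simple roots: the sum is the coefficient of X ^ (deg P -
1). -/
theorem impulse_of_lt (hmonic : P.Monic) (hroots : (P.aroots ℂ).Nodup) {i : ℕ}
    (hi : i < P.natDegree) : impulse P i = if i = P.natDegree - 1 then 1 else 0 := by
  have hc := card_complexRoots hmonic hroots
  have h := Lagrange.coeff_eq_sum (s := complexRoots P) (v := fun z => z) (P := (X ^ i : ℂ[X]))
    (fun _ _ _ _ h => h) (by rw [degree_X_pow, hc]; exact_mod_cast hi)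
  rw [hc, coeff_X_pow] at h
  simp only [eval_pow, eval_X] at h
  rw [impulse, Finset.sum_congr rfl (g := fun α => α ^ i / ∏ j ∈ (complexRoots P).erase α, (α - j))
    (fun α _ => by rw [rootWeight, div_eq_mul_inv, mul_comm]), ← h]
  simp only [eq_comm]

theorem impulse_recurrence (r : ℕ) :
    ∑ j ∈ Finset.range (P.natDegree + 1), (P.coeff j : ℂ) * impulse P (r + j) = 0 := by
  simp only [impulse, Finset.mul_sum]
  rw [Finset.sum_comm]
  refine Finset.sum_eq_zero fun α hα => ?_
  calc _ = rootWeight P α * α ^ r *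
        ∑ j ∈ Finset.range (P.natDegree + 1), (P.coeff j : ℂ) * α ^ j := by
        rw [Finset.mul_sum]
        exact Finset.sum_congr rfl fun j _ => by rw [pow_add]; ring
    _ = 0 := by rw [sum_coeff_mul_pow hα, mul_zero]

theorem exists_int_eq_impulse (hmonic : P.Monic) (hroots : (P.aroots ℂ).Nodup) (i : ℕ) :
    ∃ z : ℤ, impulse P i = z := by
  induction i using Nat.strong_induction_on with
  | _ i ih =>
    by_cases hi : i < P.natDegree
    · refine ⟨if i = P.natDegree - 1 then 1 else 0, ?_⟩
      rw [impulse_of_lt hmonic hroots hi]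
      split_ifs <;> simp
    · obtain ⟨r, rfl⟩ := Nat.exists_eq_add_of_le' (not_lt.mp hi)
      have h := impulse_recurrence (P := P) r
      rw [Finset.sum_range_succ, coeff_natDegree, hmonic.leadingCoeff] at h
      choose! z hz using ih
      refine ⟨-∑ j ∈ Finset.range P.natDegree, P.coeff j * z (r + j), ?_⟩
      rw [Finset.sum_congr rfl (g := fun j => ((P.coeff j * z (r + j) : ℤ) : ℂ)) (fun j hj => by
        rw [hz (r + j) (by have := Finset.mem_range.mp hj; omega)]; push_cast; rfl)] at h
      push_cast at h ⊢
      rw [one_mul] at h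
      exact eq_neg_of_add_eq_zero_right h

theorem expandingPart_recurrence (r : ℤ) :
    ∑ j ∈ Finset.range (P.natDegree + 1), (P.coeff j : ℂ) * expandingPart P (r + j) = 0 := by
  simp only [expandingPart, Finset.mul_sum]
  rw [Finset.sum_comm]
  refine Finset.sum_eq_zero fun α hα => ?_
  have h0 : α ≠ 0 := by
    rintro rfl
    have := one_lt_norm_of_mem_expandingRoots hα
    simp at this
    linarith
  calc _ = rootWeight P α * α ^ (r - 1) *
        ∑ j ∈ Finset.range (P.natDegree + 1), (P.coeff j : ℂ) * α ^ j := by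
        rw [Finset.mul_sum]
        refine Finset.sum_congr rfl fun j _ => ?_
        rw [show r + (j : ℤ) - 1 = (r - 1) + j by ring, zpow_add₀ h0, zpow_natCast]
        ring
    _ = 0 := by rw [sum_coeff_mul_pow (expandingRoots_subset hα), mul_zero]

theorem causalPart_recurrence (hmonic : P.Monic) (hdeg : 1 ≤ P.natDegree)
    (hroots : (P.aroots ℂ).Nodup) (r : ℤ) :
    ∑ j ∈ Finset.range (P.natDegree + 1), (P.coeff j : ℂ) * causalPart P (r + j) =
      if r = 0 then 1 else 0 := by
  have hsmall : ∀ l : ℤ, l < P.natDegree → causalPart P l = 0 := fun l hl => by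
    unfold causalPart
    split_ifs with h1
    · rw [impulse_of_lt hmonic hroots (by omega), if_neg (by omega)]
    · rfl
  rcases lt_trichotomy r 0 with h | h | h
  · rw [if_neg h.ne]
    refine Finset.sum_eq_zero fun j hj => ?_
    have := Finset.mem_range.mp hj
    rw [hsmall _ (by omega), mul_zero]
  · subst h
    rw [if_pos rfl, Finset.sum_range_succ, Finset.sum_eq_zero, coeff_natDegree,
      hmonic.leadingCoeff, causalPart, if_pos (by omega), impulse_of_lt hmonic hroots (by omega),
      if_pos (by omega)]
    · simp
    · intro j hj
      have := Finset.mem_range.mp hj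
      rw [hsmall _ (by omega), mul_zero]
  · rw [if_neg h.ne', ← impulse_recurrence (P := P) (r - 1).toNat]
    refine Finset.sum_congr rfl fun j _ => ?_
    rw [causalPart, if_pos (by omega)]
    congr 2
    omega

/-- The causal part is a fundamental solution and the expanding part a homogeneous one. Subtracting
the latter keeps the unit impulse and removes the growth. -/
theorem kernel_recurrence (hmonic : P.Monic) (hdeg : 1 ≤ P.natDegree)
    (hroots : (P.aroots ℂ).Nodup) (r : ℤ) :
    ∑ j ∈ Finset.range (P.natDegree + 1), (P.coeff j : ℝ) * kernel P (r + j) =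
      if r = 0 then 1 else 0 := by
  have h1 := congrArg Complex.re (causalPart_recurrence hmonic hdeg hroots r)
  have h2 := congrArg Complex.re (expandingPart_recurrence (P := P) r)
  rw [Complex.re_sum] at h1 h2
  have h3 : ∀ (j : ℕ) (z : ℂ), ((P.coeff j : ℂ) * z).re = (P.coeff j : ℝ) * z.re := fun j z => by
    rw [← Complex.ofReal_intCast, Complex.re_ofReal_mul]
  simp only [h3] at h1 h2
  simp only [kernel, mul_sub, Finset.sum_sub_distrib, h1, h2]
  split_ifs <;> simp

theorem exists_lt_one_bound (s : Finset ℂ) (f : ℂ → ℝ) (hf : ∀ α ∈ s, f α < 1) :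
    ∃ θ : ℝ, 0 < θ ∧ θ < 1 ∧ ∀ α ∈ s, f α ≤ θ := by
  classical
  induction s using Finset.induction_on with
  | empty => exact ⟨1 / 2, by norm_num, by norm_num, by simp⟩
  | insert a s ha ih =>
    obtain ⟨θ, h0, h1, h2⟩ := ih fun α hα => hf α (Finset.mem_insert_of_mem hα)
    refine ⟨max θ (f a), lt_max_of_lt_left h0, max_lt h1 (hf a (Finset.mem_insert_self _ _)), ?_⟩
    intro α hα
    rcases Finset.mem_insert.mp hα with rfl | h
    · exact le_max_right _ _
    · exact (h2 α h).trans (le_max_left _ _)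

/-- For l ≥ 1 the expanding roots cancel, leaving powers of roots inside the unit disc; for l ≤ 0
only negative powers of expanding roots remain. -/
theorem exists_kernel_bound (hunit : ∀ z : ℂ, ‖z‖ = 1 → Polynomial.aeval z P ≠ 0) :
    ∃ C θ : ℝ, 0 ≤ C ∧ 0 < θ ∧ θ < 1 ∧ ∀ l : ℤ, |kernel P l| ≤ C * θ ^ l.natAbs := by
  classical
  obtain ⟨θ, h0, h1, h2⟩ := exists_lt_one_bound (complexRoots P)
    (fun α => if 1 < ‖α‖ then ‖α‖⁻¹ else ‖α‖) (fun α hα => by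
      have h3 : ‖α‖ ≠ 1 := fun h => hunit α h (aeval_eq_zero_of_mem_complexRoots hα)
      split_ifs with h
      · exact inv_lt_one_of_one_lt₀ h
      · exact lt_of_le_of_ne (not_lt.mp h) h3)
  set W := ∑ α ∈ complexRoots P, ‖rootWeight P α‖ with hW
  have hW0 : 0 ≤ W := Finset.sum_nonneg fun _ _ => norm_nonneg _
  -- The factor 1/θ pays for the shift l = m + 1 on the positive side.
  refine ⟨W / θ, θ, by positivity, h0, h1, fun l => ?_⟩
  rcases lt_or_ge l 1 with hl | hl
  · obtain ⟨m, hm⟩ : ∃ m : ℕ, l = -(m : ℤ) := ⟨(-l).toNat, by omega⟩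
    have hk : kernel P l = -(expandingPart P l).re := by
      rw [kernel, causalPart, if_neg (by omega)]; simp
    have habs : l.natAbs = m := by omega
    rw [hk, abs_neg, habs]
    refine (Complex.abs_re_le_norm _).trans ?_
    have h3 : ‖expandingPart P l‖ ≤ W * θ ^ m := by
      rw [expandingPart, hW, Finset.sum_mul]
      refine (norm_sum_le_of_le (n := fun α => ‖rootWeight P α‖ * θ ^ m) _ fun α hα => ?_).trans
        (Finset.sum_le_sum_of_subset_of_nonneg expandingRoots_subset fun _ _ _ => by positivity)
      have h4 := h2 α (expandingRoots_subset hα)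
      have h5 := one_lt_norm_of_mem_expandingRoots hα
      simp only [if_pos h5] at h4
      rw [norm_mul, norm_zpow]
      gcongr
      rw [hm, show -(m : ℤ) - 1 = -((m + 1 : ℕ) : ℤ) by push_cast; ring, zpow_neg, zpow_natCast,
        ← inv_pow]
      calc ‖α‖⁻¹ ^ (m + 1) ≤ ‖α‖⁻¹ ^ m := pow_le_pow_of_le_one (by positivity) (h4.trans h1.le)
            (Nat.le_succ m)
        _ ≤ θ ^ m := by gcongr
    refine h3.trans ?_
    gcongr
    exact le_div_self hW0 h0 h1.le
  · obtain ⟨m, hm⟩ : ∃ m : ℕ, l = (m : ℤ) + 1 := ⟨(l - 1).toNat, by omega⟩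
    have habs : l.natAbs = m + 1 := by omega
    have hk : kernel P l = (∑ α ∈ complexRoots P \ expandingRoots P,
        rootWeight P α * α ^ m).re := by
      rw [kernel, causalPart, if_pos hl, ← Complex.sub_re, impulse, expandingPart,
        ← Finset.sum_sdiff (expandingRoots_subset (P := P)), hm]
      simp
    rw [hk, habs]
    refine (Complex.abs_re_le_norm _).trans ?_
    have h3 : ‖∑ α ∈ complexRoots P \ expandingRoots P, rootWeight P α * α ^ m‖ ≤ W * θ ^ m := by
      rw [hW, Finset.sum_mul]
      refine (norm_sum_le_of_le (n := fun α => ‖rootWeight P α‖ * θ ^ m) _ fun α hα => ?_).trans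
        (Finset.sum_le_sum_of_subset_of_nonneg Finset.sdiff_subset fun _ _ _ => by positivity)
      rw [Finset.mem_sdiff] at hα
      have h4 := h2 α hα.1
      have h5 : ¬ 1 < ‖α‖ := fun h => hα.2 (mem_expandingRoots_iff.mpr ⟨hα.1, h⟩)
      simp only [if_neg h5] at h4
      rw [norm_mul, norm_pow]
      gcongr
    refine h3.trans (le_of_eq ?_)
    rw [pow_succ]
    field_simp

/-- Otherwise the product of the roots would have modulus below 1, yet up to sign it is a nonzero
integer. -/
theorem expandingRoots_nonempty (hmonic : P.Monic) (hdeg : 1 ≤ P.natDegree)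
    (hconst : P.coeff 0 ≠ 0) (hunit : ∀ z : ℂ, ‖z‖ = 1 → Polynomial.aeval z P ≠ 0) :
    (expandingRoots P).Nonempty := by
  classical
  by_contra hne
  rw [Finset.not_nonempty_iff_eq_empty] at hne
  have hlt : ∀ α ∈ P.aroots ℂ, ‖α‖ < 1 := fun α hα => by
    have h1 : α ∈ complexRoots P := by rw [complexRoots, Multiset.mem_toFinset]; exact hα
    have h2 : ‖α‖ ≠ 1 := fun h => hunit α h (aeval_eq_zero_of_mem_complexRoots h1)
    have h3 : ¬ 1 < ‖α‖ := fun h => by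
      have := mem_expandingRoots_iff.mpr ⟨h1, h⟩
      rw [hne] at this
      simp at this
    exact lt_of_le_of_ne (not_lt.mp h3) h2
  have hm := hmonic.map (algebraMap ℤ ℂ)
  have hcard : Multiset.card (P.aroots ℂ) = P.natDegree := by
    rw [aroots, IsAlgClosed.card_roots_eq_natDegree, hmonic.natDegree_map]
  have hprod := (IsAlgClosed.splits (P.map (algebraMap ℤ ℂ))).coeff_zero_eq_prod_roots_of_monic hm
  have hnorm := congrArg norm hprod
  rw [coeff_map, norm_mul, norm_pow, norm_neg, norm_one, one_pow, one_mul] at hnorm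
  have hge : (1 : ℝ) ≤ ‖(algebraMap ℤ ℂ) (P.coeff 0)‖ := by
    simp only [algebraMap_int_eq, eq_intCast, Complex.norm_intCast]
    exact_mod_cast Int.one_le_abs hconst
  have hprodlt : ∀ s : Multiset ℂ, (∀ α ∈ s, ‖α‖ < 1) → s ≠ 0 → ‖s.prod‖ < 1 := by
    intro s
    induction s using Multiset.induction_on with
    | empty => simp
    | cons a s ih =>
      intro h _
      rw [Multiset.prod_cons, norm_mul]
      have ha := h a (Multiset.mem_cons_self a s)
      by_cases hs : s = 0
      · simpa [hs] using ha
      · have := ih (fun α hα => h α (Multiset.mem_cons_of_mem hα)) hs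
        exact mul_lt_one_of_nonneg_of_lt_one_left (norm_nonneg _) ha this.le
  have := hprodlt _ hlt (by
    intro h0
    rw [h0] at hcard
    simp at hcard
    omega)
  rw [aroots] at this
  linarith

end Kernel

/-! ### Initial values built from integer defects. -/

section InitialValues

variable {P : ℤ[X]} {k : ℕ}

/-- Complex conjugation on the roots of modulus greater than one. -/
noncomputable def conjRoot (α : expandingRoots P) : expandingRoots P :=
  ⟨(starRingEnd ℂ) (α : ℂ), conj_mem_expandingRoots α.2⟩

theorem conjRoot_involutive : Function.Involutive (conjRoot (P := P)) := fun α =>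
  Subtype.ext (Complex.conj_conj (α : ℂ))

/-- The initial value with constant polynomials obtained by symmetrizing a family of complex
numbers. -/
noncomputable def InitialValue.ofConst (k : ℕ) (A : expandingRoots P → ℂ) : InitialValue P k where
  poly α := C ((A α + (starRingEnd ℂ) (A (conjRoot α))) / 2)
  natDegree_le α := by simp
  conj_eq α β h := by
    have h1 : β = conjRoot α := Subtype.ext h
    rw [h1, conjRoot_involutive α, Polynomial.map_C]
    simp [add_comm, map_ofNat (starRingEnd ℂ) 2]

theorem InitialValue.seq_ofConst (A : expandingRoots P → ℂ) (n : ℕ) :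
    (InitialValue.ofConst k A).seq n = (∑ α : expandingRoots P, A α * (α : ℂ) ^ n).re := by
  set T := ∑ α : expandingRoots P, A α * (α : ℂ) ^ n with hT
  have h1 : ∑ α : expandingRoots P, (starRingEnd ℂ) (A (conjRoot α)) * (α : ℂ) ^ n =
      (starRingEnd ℂ) T := by
    rw [hT, map_sum]
    refine Fintype.sum_equiv conjRoot_involutive.toPerm _ _ fun α => ?_
    simp [conjRoot]
  have h2 : (InitialValue.ofConst k A).complexSeq n = (T + (starRingEnd ℂ) T) / 2 := by
    rw [← h1, hT, ← Finset.sum_add_distrib, Finset.sum_div]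
    refine Finset.sum_congr rfl fun α _ => ?_
    simp only [InitialValue.ofConst, eval_C]
    ring
  rw [InitialValue.seq, h2, Complex.add_conj]
  simp

theorem InitialValue.continuous_ofConst {B : Type*} [TopologicalSpace B]
    {A : B → expandingRoots P → ℂ} (hA : ∀ α, Continuous fun b => A b α) :
    Continuous fun b => InitialValue.ofConst k (A b) := by
  refine continuous_induced_rng.mpr (continuous_pi fun α => continuous_pi fun i => ?_)
  simp only [Function.comp_def, InitialValue.coeffs, InitialValue.ofConst, coeff_C]
  split_ifs
  · exact ((hA α).add (Complex.continuous_conj.comp (hA _))).div_const 2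
  · exact continuous_const

theorem InitialValue.continuous_seq (n : ℕ) :
    Continuous fun g : InitialValue P k => g.seq n := by
  have hc : ∀ (α : expandingRoots P) (i : Fin (k + 1)),
      Continuous fun g : InitialValue P k => (g.poly α).coeff i := fun α i =>
    (continuous_apply i).comp ((continuous_apply α).comp
      (continuous_induced_dom (f := InitialValue.coeffs (P := P) (k := k))))
  refine Complex.continuous_re.comp (continuous_finsetSum _ fun α _ => ?_)
  refine Continuous.mul ?_ continuous_const
  have : ∀ g : InitialValue P k, (g.poly α).eval (n : ℂ) =
      ∑ i : Fin (k + 1), (g.poly α).coeff i * (n : ℂ) ^ (i : ℕ) := fun g => by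
    rw [eval_eq_sum_range' (Nat.lt_succ_of_le (g.natDegree_le α)),
      Finset.sum_range (fun i => (g.poly α).coeff i * (n : ℂ) ^ i)]
  simp_rw [this]
  exact continuous_finsetSum _ fun i _ => (hc α i).mul continuous_const

/-- The coefficients attached to a bounded integer sequence of defects. -/
noncomputable def defectCoeff (P : ℤ[X]) (σ : ℕ → ℤ) (α : expandingRoots P) : ℂ :=
  ∑' m : ℕ, (σ m : ℂ) * (rootWeight P α * (α : ℂ) ^ (-(m : ℤ) - 1))

theorem norm_defectCoeff_term_le {σ : ℕ → ℤ} {M : ℝ} (hσ : ∀ m, |(σ m : ℝ)| ≤ M)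
    (α : expandingRoots P) (m : ℕ) :
    ‖(σ m : ℂ) * (rootWeight P α * (α : ℂ) ^ (-(m : ℤ) - 1))‖ ≤
      M * (‖rootWeight P α‖ * ‖(α : ℂ)‖⁻¹ ^ (m + 1)) := by
  rw [norm_mul, norm_mul, Complex.norm_intCast, norm_zpow,
    show -(m : ℤ) - 1 = -((m + 1 : ℕ) : ℤ) by push_cast; ring, zpow_neg, zpow_natCast, inv_pow]
  gcongr
  exact hσ m

theorem summable_defectCoeff_bound (M : ℝ) (α : expandingRoots P) :
    Summable fun m : ℕ => M * (‖rootWeight P α‖ * ‖(α : ℂ)‖⁻¹ ^ (m + 1)) := by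
  refine Summable.mul_left _ (Summable.mul_left _ ?_)
  exact (summable_nat_add_iff 1).mpr (summable_geometric_of_lt_one (by positivity)
    (inv_lt_one_of_one_lt₀ (one_lt_norm_of_mem_expandingRoots α.2)))

theorem continuous_defectCoeff {B : Type*} [TopologicalSpace B] {σ : B → ℕ → ℤ} {M : ℝ}
    (hσ : ∀ b m, |(σ b m : ℝ)| ≤ M) (hc : ∀ m, Continuous fun b => σ b m)
    (α : expandingRoots P) : Continuous fun b => defectCoeff P (σ b) α :=
  continuous_tsum (fun m => (continuous_of_discreteTopology.comp (hc m)).mul continuous_const)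
    (summable_defectCoeff_bound M α) fun m b => norm_defectCoeff_term_le (hσ b) α m

/-- The left side is the convolution of σ with the expanding part, that is, with the causal part
minus the kernel. The causal convolution at n is a finite sum over m < n of integers. -/
theorem exists_int_sum_defectCoeff (hmonic : P.Monic) (hroots : (P.aroots ℂ).Nodup)
    {σ : ℕ → ℤ} {M : ℝ} (hσ : ∀ m, |(σ m : ℝ)| ≤ M) (n : ℕ)
    (hs : Summable fun m : ℕ => (σ m : ℝ) * kernel P (n - m)) :
    ∃ z : ℤ, (∑ α : expandingRoots P, defectCoeff P σ α * (α : ℂ) ^ n).re =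
      z - ∑' m : ℕ, (σ m : ℝ) * kernel P (n - m) := by
  have hterm : ∀ α : expandingRoots P, HasSum (fun m : ℕ => (σ m : ℂ) *
      (rootWeight P α * (α : ℂ) ^ ((n : ℤ) - m - 1))) (defectCoeff P σ α * (α : ℂ) ^ n) := fun α => by
    have h0 : (α : ℂ) ≠ 0 := by
      rw [← norm_pos_iff]
      linarith [one_lt_norm_of_mem_expandingRoots α.2]
    have h1 : Summable fun m : ℕ => (σ m : ℂ) * (rootWeight P α * (α : ℂ) ^ (-(m : ℤ) - 1)) :=
      .of_norm_bounded (summable_defectCoeff_bound M α) (norm_defectCoeff_term_le hσ α)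
    convert! h1.hasSum.mul_right ((α : ℂ) ^ n) using 2 with m
    rw [show (n : ℤ) - m - 1 = (-(m : ℤ) - 1) + n by ring, zpow_add₀ h0, zpow_natCast]
    ring
  have h1 := Complex.hasSum_re (hasSum_sum (s := Finset.univ) fun α _ => hterm α)
  have h2 : ∀ m : ℕ, (∑ α : expandingRoots P, (σ m : ℂ) *
      (rootWeight P α * (α : ℂ) ^ ((n : ℤ) - m - 1))).re =
      (σ m : ℝ) * (causalPart P (n - m)).re - (σ m : ℝ) * kernel P (n - m) := fun m => by
    rw [← Finset.mul_sum, ← mul_sub, kernel, sub_sub_cancel, expandingPart,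
      ← Complex.ofReal_intCast, Complex.re_ofReal_mul]
    congr 2
    exact Finset.sum_coe_sort (expandingRoots P)
      fun α => rootWeight P α * α ^ ((n : ℤ) - m - 1)
  simp only [h2] at h1
  have h3 := h1.add hs.hasSum
  simp only [sub_add_cancel] at h3
  have h4 : HasSum (fun m : ℕ => (σ m : ℝ) * (causalPart P (n - m)).re)
      (∑ m ∈ Finset.range n, (σ m : ℝ) * (causalPart P (n - m)).re) :=
    hasSum_sum_of_ne_finset_zero fun m hm => by
      rw [Finset.mem_range] at hm
      rw [causalPart, if_neg (by omega)]
      simp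
  choose z hz using exists_int_eq_impulse hmonic hroots
  refine ⟨∑ m ∈ Finset.range n, σ m * z (n - m - 1), ?_⟩
  rw [eq_sub_iff_add_eq, h3.unique h4]
  push_cast
  refine Finset.sum_congr rfl fun m hm => ?_
  rw [Finset.mem_range] at hm
  rw [causalPart, if_pos (by omega), show ((n : ℤ) - m - 1).toNat = n - m - 1 by omega, hz]
  simp

end InitialValues

end RecurrenceNormal

namespace RecurrenceNormal

/-! ### Convolution with exponentially decaying kernels. -/

section Convolution

/-- The sum of the two-sided geometric series. -/
noncomputable def geomSum (θ : ℝ) : ℝ := ∑' l : ℤ, θ ^ l.natAbs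

variable {θ : ℝ}

theorem summable_pow_natAbs (h0 : 0 < θ) (h1 : θ < 1) : Summable fun l : ℤ => θ ^ l.natAbs := by
  have h := summable_geometric_of_lt_one h0.le h1
  exact Summable.of_nat_of_neg (by simpa using h) (by simpa using h)

theorem summable_pow_natAbs_sub (h0 : 0 < θ) (h1 : θ < 1) (a : ℤ) :
    Summable fun m : ℕ => θ ^ (a - m).natAbs :=
  (summable_pow_natAbs h0 h1).comp_injective (i := fun m : ℕ => a - (m : ℤ))
    fun m n h => by simpa using h

theorem geomSum_nonneg (h0 : 0 < θ) : 0 ≤ geomSum θ := tsum_nonneg fun _ => by positivity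

theorem sum_pow_natAbs_le (h0 : 0 < θ) (h1 : θ < 1) (s : Finset ℕ) (a : ℤ) :
    ∑ n ∈ s, θ ^ ((n : ℤ) - a).natAbs ≤ geomSum θ := by
  classical
  have hinj : Set.InjOn (fun n : ℕ => (n : ℤ) - a) s := fun m _ n _ h => by simpa using h
  rw [← Finset.sum_image (f := fun l : ℤ => θ ^ l.natAbs) hinj]
  exact (summable_pow_natAbs h0 h1).sum_le_tsum _ fun _ _ => by positivity

theorem tsum_pow_natAbs_le (h0 : 0 < θ) (h1 : θ < 1) (a : ℤ) :
    ∑' m : ℕ, θ ^ (a - m).natAbs ≤ geomSum θ := by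
  refine (summable_pow_natAbs_sub h0 h1 a).tsum_le_of_sum_le fun s => ?_
  refine le_of_eq_of_le (Finset.sum_congr rfl fun n _ => ?_) (sum_pow_natAbs_le h0 h1 s a)
  congr 1
  omega

variable {c : ℤ → ℝ} {C : ℝ}

theorem summable_mul_kernel (h0 : 0 < θ) (h1 : θ < 1) (hc : ∀ l, |c l| ≤ C * θ ^ l.natAbs)
    {τ : ℕ → ℝ} {M : ℝ} (hτ : ∀ m, |τ m| ≤ M) (a : ℤ) :
    Summable fun m : ℕ => τ m * c (a - m) := by
  refine .of_norm_bounded (((summable_pow_natAbs_sub h0 h1 a).mul_left C).mul_left M) fun m => ?_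
  rw [Real.norm_eq_abs, abs_mul]
  exact mul_le_mul (hτ m) (hc _) (abs_nonneg _) ((abs_nonneg _).trans (hτ m))

/-- Convolution with an exponentially decaying kernel, summed over a block: up to a bounded error,
only the nonzero terms inside the block contribute. -/
theorem sum_Ico_abs_convolution_le (h0 : 0 < θ) (h1 : θ < 1) (hC : 0 ≤ C)
    (hc : ∀ l, |c l| ≤ C * θ ^ l.natAbs) {τ : ℕ → ℝ} {M : ℝ} (hτ : ∀ m, |τ m| ≤ M) (A B : ℕ)
    [DecidablePred fun m => τ m ≠ 0] :
    ∑ n ∈ Finset.Ico A B, |∑' m : ℕ, τ m * c ((n : ℤ) - m)| ≤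
      M * C * geomSum θ * ((((Finset.Ico A B).filter fun m => τ m ≠ 0).card : ℝ)
        + 2 * geomSum θ) := by
  have hM : 0 ≤ M := (abs_nonneg _).trans (hτ 0)
  have hD := geomSum_nonneg h0
  let T : ℕ → ℝ := fun m => ∑ n ∈ Finset.Ico A B, θ ^ ((n : ℤ) - m).natAbs
  let K := (Finset.Ico A B).filter fun m => τ m ≠ 0
  -- A weight dominating, up to a constant factor, the mass that position m sends into the block: 1
  -- at the nonzero terms inside, and decay from the two ends for positions outside.
  let u : ℕ → ℝ := fun m =>
    (if m ∈ K then 1 else 0) + (θ ^ ((A : ℤ) - m).natAbs + θ ^ ((B : ℤ) - m).natAbs)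
  have hu1 : HasSum (fun m => if m ∈ K then (1 : ℝ) else 0) K.card := by
    have : HasSum (fun m => if m ∈ K then (1 : ℝ) else 0)
        (∑ m ∈ K, if m ∈ K then (1 : ℝ) else 0) :=
      hasSum_sum_of_ne_finset_zero fun m hm => if_neg hm
    simpa using this
  have hu2 := (summable_pow_natAbs_sub h0 h1 A).add (summable_pow_natAbs_sub h0 h1 B)
  have hus : Summable u := hu1.summable.add hu2
  have hut : ∑' m, u m ≤ K.card + 2 * geomSum θ := by
    rw [hu1.summable.tsum_add hu2, hu1.tsum_eq,
      (summable_pow_natAbs_sub h0 h1 A).tsum_add (summable_pow_natAbs_sub h0 h1 B)]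
    linarith [tsum_pow_natAbs_le h0 h1 (A : ℤ), tsum_pow_natAbs_le h0 h1 (B : ℤ)]
  have hsumm : ∀ n : ℕ, Summable fun m : ℕ => |τ m| * (C * θ ^ ((n : ℤ) - m).natAbs) := fun n => by
    refine .of_nonneg_of_le (fun m => by positivity) (fun m => ?_)
      (((summable_pow_natAbs_sub h0 h1 n).mul_left C).mul_left M)
    gcongr
    exact hτ m
  have hTu : ∀ m, |τ m| * T m ≤ M * geomSum θ * u m := fun m => by
    have hu0 : 0 ≤ u m := by
      simp only [u]
      split_ifs <;> positivity
    by_cases hm : m ∈ Finset.Ico A B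
    · by_cases h : τ m = 0
      · rw [h, abs_zero, zero_mul]; positivity
      · have h2 : 1 ≤ u m := by
          simp only [u, K]
          rw [if_pos (Finset.mem_filter.mpr ⟨hm, h⟩)]
          have : 0 ≤ θ ^ ((A : ℤ) - m).natAbs + θ ^ ((B : ℤ) - m).natAbs := by positivity
          linarith
        calc |τ m| * T m ≤ M * geomSum θ :=
              mul_le_mul (hτ m) (sum_pow_natAbs_le h0 h1 _ _)
                (Finset.sum_nonneg fun _ _ => by positivity) hM
          _ ≤ M * geomSum θ * u m := le_mul_of_one_le_right (by positivity) h2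
    -- For m outside the block, the path from m to any n in it passes the end E, so the distances
    -- add and θ to the distance factors.
    · have key : ∀ E : ℕ, (∀ n ∈ Finset.Ico A B, ((n : ℤ) - m).natAbs =
          ((n : ℤ) - E).natAbs + ((E : ℤ) - m).natAbs) →
          T m ≤ geomSum θ * θ ^ ((E : ℤ) - m).natAbs := fun E hE => by
        have : T m = (∑ n ∈ Finset.Ico A B, θ ^ ((n : ℤ) - E).natAbs) *
            θ ^ ((E : ℤ) - m).natAbs := by
          rw [Finset.sum_mul]
          exact Finset.sum_congr rfl fun n hn => by rw [hE n hn, pow_add]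
        rw [this]
        gcongr
        exact sum_pow_natAbs_le h0 h1 _ _
      have h2 : T m ≤ geomSum θ * u m := by
        rw [Finset.mem_Ico, not_and_or, not_le, not_lt] at hm
        have hi : (0 : ℝ) ≤ if m ∈ K then 1 else 0 := by split_ifs <;> norm_num
        have hA : 0 ≤ θ ^ ((A : ℤ) - m).natAbs := by positivity
        have hB : 0 ≤ θ ^ ((B : ℤ) - m).natAbs := by positivity
        rcases hm with hm | hm
        · refine (key A fun n hn => ?_).trans ?_
          · rw [Finset.mem_Ico] at hn; omega
          · gcongr; simp only [u]; linarith
        · refine (key B fun n hn => ?_).trans ?_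
          · rw [Finset.mem_Ico] at hn; omega
          · gcongr; simp only [u]; linarith
      calc |τ m| * T m ≤ M * (geomSum θ * u m) :=
            mul_le_mul (hτ m) h2 (Finset.sum_nonneg fun _ _ => by positivity) hM
        _ = _ := by ring
  calc ∑ n ∈ Finset.Ico A B, |∑' m : ℕ, τ m * c ((n : ℤ) - m)|
      ≤ ∑ n ∈ Finset.Ico A B, ∑' m : ℕ, |τ m| * (C * θ ^ ((n : ℤ) - m).natAbs) := by
        refine Finset.sum_le_sum fun n _ => ?_
        rw [← Real.norm_eq_abs]
        refine tsum_of_norm_bounded (hsumm n).hasSum fun m => ?_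
        rw [Real.norm_eq_abs, abs_mul]
        gcongr
        exact hc _
    _ = ∑' m : ℕ, ∑ n ∈ Finset.Ico A B, |τ m| * (C * θ ^ ((n : ℤ) - m).natAbs) :=
        (Summable.tsum_finsetSum fun n _ => hsumm n).symm
    _ ≤ ∑' m : ℕ, C * (M * geomSum θ * u m) := by
        refine Summable.tsum_le_tsum (fun m => ?_) (summable_sum fun n _ => hsumm n)
          ((hus.mul_left _).mul_left _)
        calc ∑ n ∈ Finset.Ico A B, |τ m| * (C * θ ^ ((n : ℤ) - m).natAbs)
            = C * (|τ m| * T m) := by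
              simp only [T]
              rw [Finset.mul_sum, Finset.mul_sum]
              exact Finset.sum_congr rfl fun n _ => by ring
          _ ≤ _ := mul_le_mul_of_nonneg_left (hTu m) hC
    _ = M * C * geomSum θ * ∑' m, u m := by
        rw [tsum_mul_left, tsum_mul_left]; ring
    _ ≤ _ := by gcongr

/-- If the kernel inverts a finite recurrence operator, then convolving the defects of a bounded
sequence with the kernel gives the sequence back, up to an exponentially small error. -/
theorem abs_sub_convolution_defect_le (h0 : 0 < θ) (h1 : θ < 1)
    (hc : ∀ l, |c l| ≤ C * θ ^ l.natAbs) {p : ℕ → ℝ} {d : ℕ}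
    (hrec : ∀ r : ℤ, ∑ j ∈ Finset.range (d + 1), p j * c (r + j) = if r = 0 then 1 else 0)
    {ε : ℕ → ℝ} (hε : ∀ n, |ε n| ≤ 1) (n : ℕ) :
    |ε n - ∑' m : ℕ, (∑ j ∈ Finset.range (d + 1), p j * ε (m + j)) * c ((n : ℤ) - m)| ≤
      (C * ∑ j ∈ Finset.range (d + 1), |p j| * j) * θ ^ n := by
  have hs : ∀ a : ℤ, Summable fun m : ℕ => ε m * c (a - m) := summable_mul_kernel h0 h1 hc hε
  have hshift : ∀ j : ℕ, Summable fun m : ℕ => ε (m + j) * c ((n : ℤ) - m) := fun j =>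
    summable_mul_kernel h0 h1 hc (fun m => hε (m + j)) n
  -- Moving the shift from ε to the kernel loses the j initial terms. They are the only source of
  -- error, and there the kernel argument n + j - l exceeds n.
  have hsplit : ∀ j : ℕ, ∑' m : ℕ, ε (m + j) * c ((n : ℤ) - m) =
      ∑' m : ℕ, ε m * c ((n : ℤ) + j - m) -
        ∑ l ∈ Finset.range j, ε l * c ((n : ℤ) + j - l) := fun j => by
    rw [← (hs ((n : ℤ) + j)).sum_add_tsum_nat_add j, add_sub_cancel_left]
    refine tsum_congr fun m => ?_
    congr 2
    push_cast
    ring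
  have hconv : ∑' m : ℕ, (∑ j ∈ Finset.range (d + 1), p j * ε (m + j)) * c ((n : ℤ) - m) =
      ∑ j ∈ Finset.range (d + 1), p j * ∑' m : ℕ, ε (m + j) * c ((n : ℤ) - m) := by
    simp_rw [← tsum_mul_left]
    rw [← Summable.tsum_finsetSum fun j _ => (hshift j).mul_left (p j)]
    refine tsum_congr fun m => ?_
    rw [Finset.sum_mul]
    exact Finset.sum_congr rfl fun j _ => by ring
  have hdelta : ∑ j ∈ Finset.range (d + 1), p j * ∑' m : ℕ, ε m * c ((n : ℤ) + j - m) = ε n := by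
    simp_rw [← tsum_mul_left]
    rw [← Summable.tsum_finsetSum fun (j : ℕ) _ => (hs ((n : ℤ) + j)).mul_left (p j)]
    rw [tsum_eq_single n]
    · have h2 := hrec 0
      rw [if_pos rfl] at h2
      calc _ = ε n * ∑ j ∈ Finset.range (d + 1), p j * c (0 + j) := by
            rw [Finset.mul_sum]
            refine Finset.sum_congr rfl fun j _ => ?_
            rw [show (n : ℤ) + j - n = 0 + j by ring]
            ring
        _ = ε n := by rw [h2, mul_one]
    · intro m hm
      have h2 := hrec ((n : ℤ) - m)
      rw [if_neg (by omega)] at h2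
      calc _ = ε m * ∑ j ∈ Finset.range (d + 1), p j * c ((n : ℤ) - m + j) := by
            rw [Finset.mul_sum]
            refine Finset.sum_congr rfl fun j _ => ?_
            rw [show (n : ℤ) + j - m = n - m + j by ring]
            ring
        _ = 0 := by rw [h2, mul_zero]
  have herr : ε n - ∑' m : ℕ, (∑ j ∈ Finset.range (d + 1), p j * ε (m + j)) * c ((n : ℤ) - m) =
      ∑ j ∈ Finset.range (d + 1), p j * ∑ l ∈ Finset.range j, ε l * c ((n : ℤ) + j - l) := by
    rw [hconv]
    simp_rw [hsplit, mul_sub]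
    rw [Finset.sum_sub_distrib, hdelta]
    ring
  rw [herr, Finset.mul_sum, Finset.sum_mul]
  refine (Finset.abs_sum_le_sum_abs _ _).trans (Finset.sum_le_sum fun j _ => ?_)
  rw [abs_mul]
  have h3 : |∑ l ∈ Finset.range j, ε l * c ((n : ℤ) + j - l)| ≤ j * (C * θ ^ n) := by
    refine (Finset.abs_sum_le_sum_abs _ _).trans ?_
    have : ∀ l ∈ Finset.range j, |ε l * c ((n : ℤ) + j - l)| ≤ C * θ ^ n := fun l hl => by
      rw [Finset.mem_range] at hl
      have hCθ : 0 ≤ C * θ ^ ((n : ℤ) + j - l).natAbs := (abs_nonneg _).trans (hc _)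
      have hC : 0 ≤ C := nonneg_of_mul_nonneg_left hCθ (by positivity)
      rw [abs_mul]
      calc |ε l| * |c ((n : ℤ) + j - l)| ≤ 1 * (C * θ ^ ((n : ℤ) + j - l).natAbs) :=
            mul_le_mul (hε l) (hc _) (abs_nonneg _) zero_le_one
        _ ≤ C * θ ^ n := by
            rw [one_mul]
            gcongr ?_ * ?_
            exact pow_le_pow_of_le_one h0.le h1.le (by omega)
    refine (Finset.sum_le_sum this).trans ?_
    rw [Finset.sum_const, Finset.card_range, nsmul_eq_mul]
  calc |p j| * _ ≤ |p j| * (j * (C * θ ^ n)) := by gcongr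
    _ = _ := by ring

end Convolution

/-! ### Modified times in dyadic blocks. -/

section Blocks

/-- The times at which the sequence is modified: an initial part of relative length
`1 / (β j + 1)` of each dyadic block. -/
def modified (β : ℕ → ℕ) (m : ℕ) : Prop :=
  1 ≤ m ∧ m < 2 ^ Nat.log 2 m + 2 ^ Nat.log 2 m / (β (Nat.log 2 m) + 1)

theorem modified_of_mem_Ico {β : ℕ → ℕ} {j m : ℕ}
    (hm : m ∈ Finset.Ico (2 ^ j) (2 ^ j + 2 ^ j / (β j + 1))) : modified β m := by
  rw [Finset.mem_Ico] at hm
  have h1 : 2 ^ j / (β j + 1) ≤ 2 ^ j := Nat.div_le_self _ _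
  have hlog : Nat.log 2 m = j := by
    refine Nat.log_eq_of_pow_le_of_lt_pow hm.1 ?_
    rw [pow_succ]
    omega
  refine ⟨(Nat.one_le_two_pow).trans hm.1, ?_⟩
  rw [hlog]
  exact hm.2

open Classical in
-- Once β ≥ k from the block j₀ on, the later blocks meeting [0, N) contribute at most the sum of
-- 2^j/(k+1) over 2^j ≤ N, which is at most 2N/(k+1).
theorem tendsto_card_modified_div {β : ℕ → ℕ} (hβ : Tendsto β atTop atTop) :
    Tendsto (fun N : ℕ => (((Finset.range N).filter (modified β)).card : ℝ) / (N : ℝ))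
      atTop (𝓝 0) := by
  have key : ∀ k : ℕ, ∃ j₀ : ℕ, ∀ N : ℕ, 0 < N →
      (((Finset.range N).filter (modified β)).card : ℝ) ≤ 2 ^ j₀ + 2 * N / ((k : ℝ) + 1) := by
    intro k
    obtain ⟨j₀, hj₀⟩ := eventually_atTop.mp (hβ.eventually_ge_atTop k)
    refine ⟨j₀, fun N hN => ?_⟩
    have hsub : (Finset.range N).filter (modified β) ⊆ Finset.range (2 ^ j₀) ∪
        (Finset.range (Nat.log 2 N + 1)).biUnion
          fun j => Finset.Ico (2 ^ j) (2 ^ j + 2 ^ j / (k + 1)) := by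
      intro m hm
      rw [Finset.mem_filter, Finset.mem_range] at hm
      obtain ⟨hmN, hm1, hm2⟩ := hm
      rw [Finset.mem_union]
      by_cases h : m < 2 ^ j₀
      · exact Or.inl (Finset.mem_range.mpr h)
      · right
        rw [Finset.mem_biUnion]
        refine ⟨Nat.log 2 m, ?_, ?_⟩
        · rw [Finset.mem_range]
          exact Nat.lt_succ_of_le (Nat.log_mono_right hmN.le)
        · rw [Finset.mem_Ico]
          refine ⟨Nat.pow_log_le_self 2 (by omega), hm2.trans_le ?_⟩
          have h2 : j₀ ≤ Nat.log 2 m := Nat.le_log_of_pow_le (by norm_num) (not_lt.mp h)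
          have := hj₀ _ h2
          gcongr
    have hcard := (Finset.card_le_card hsub).trans ((Finset.card_union_le _ _).trans
      (Nat.add_le_add_left Finset.card_biUnion_le _))
    simp only [Finset.card_range, Nat.card_Ico, add_tsub_cancel_left] at hcard
    have hcast : (((Finset.range N).filter (modified β)).card : ℝ) ≤
        2 ^ j₀ + ∑ j ∈ Finset.range (Nat.log 2 N + 1), ((2 ^ j / (k + 1) : ℕ) : ℝ) := by
      exact_mod_cast hcard
    refine hcast.trans ?_
    gcongr
    calc ∑ j ∈ Finset.range (Nat.log 2 N + 1), ((2 ^ j / (k + 1) : ℕ) : ℝ)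
        ≤ ∑ j ∈ Finset.range (Nat.log 2 N + 1), (2 : ℝ) ^ j / ((k : ℝ) + 1) := by
          refine Finset.sum_le_sum fun j _ => ?_
          refine Nat.cast_div_le.trans ?_
          push_cast
          rfl
      _ = ((2 : ℝ) ^ (Nat.log 2 N + 1) - 1) / ((k : ℝ) + 1) := by
          rw [← Finset.sum_div, geom_sum_eq (by norm_num)]
          norm_num
      _ ≤ 2 * N / ((k : ℝ) + 1) := by
          gcongr
          have : (2 : ℝ) ^ Nat.log 2 N ≤ N := by
            exact_mod_cast Nat.pow_log_le_self 2 hN.ne'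
          rw [pow_succ]
          linarith
  rw [Metric.tendsto_atTop]
  intro ε hε
  obtain ⟨k, hk⟩ := exists_nat_one_div_lt (show (0 : ℝ) < ε / 4 by positivity)
  obtain ⟨j₀, hj₀⟩ := key k
  obtain ⟨N₀, hN₀⟩ := exists_nat_gt ((2 : ℝ) ^ j₀ / (ε / 2))
  refine ⟨N₀ + 1, fun N hN => ?_⟩
  have hNpos : (0 : ℝ) < N := by
    have : 0 < N := by omega
    exact_mod_cast this
  have h1 := hj₀ N (by omega)
  rw [dist_zero_right, Real.norm_of_nonneg (by positivity), div_lt_iff₀ hNpos]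
  have h2 : (2 : ℝ) ^ j₀ < ε / 2 * N := by
    rw [div_lt_iff₀ (by positivity)] at hN₀
    have : (N₀ : ℝ) ≤ N := by exact_mod_cast (Nat.le_succ _).trans hN
    nlinarith
  have h3 : 2 * (N : ℝ) / ((k : ℝ) + 1) ≤ ε / 2 * N := by
    rw [show 2 * (N : ℝ) / ((k : ℝ) + 1) = 2 * N * (1 / ((k : ℝ) + 1)) by ring]
    nlinarith
  linarith

/-- A sequence that is close to integers on blocks `[2 ^ j, 2 ^ j + 2 ^ j / (β j + 1))`, with a
bounded total error on each block, is not uniformly distributed if `β` does not tend to infinity. -/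
theorem not_weylSums_of_blocks {y : ℕ → ℝ} {β : ℕ → ℕ} {K : ℝ}
    (hK : ∀ j, ∑ n ∈ Finset.Ico (2 ^ j) (2 ^ j + 2 ^ j / (β j + 1)), |y n| ≤ K)
    (hβ : ¬ Tendsto β atTop atTop) : ¬ WeylSums y := by
  intro hW
  have hlim := hW 1 one_ne_zero
  rw [tendsto_atTop] at hβ
  push Not at hβ
  obtain ⟨k, hk⟩ := hβ
  set S : ℕ → ℂ := fun N => ∑ n ∈ Finset.range N, fourier 1 (y n : UnitAddCircle) with hS
  -- Chosen so that the bounds for S (A + L) and S A, together at most 3ηA, give only half of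
  -- A/(k+1), whereas L is at least A/(k+1) - 1.
  set η : ℝ := 1 / (6 * ((k : ℝ) + 1)) with hη
  have hη0 : 0 < η := by positivity
  obtain ⟨N₀, hN₀⟩ := (Metric.tendsto_atTop.mp hlim) η hη0
  have hSb : ∀ N, N₀ ≤ N → ‖S N‖ ≤ η * N := fun N hN => by
    have h1 := hN₀ N hN
    rw [dist_zero_right, norm_div, Complex.norm_natCast] at h1
    rcases Nat.eq_zero_or_pos N with rfl | h
    · simp [S]
    · exact ((div_lt_iff₀ (by exact_mod_cast h)).mp h1).le
  have hbig : Tendsto (fun j : ℕ => (2 : ℝ) ^ j) atTop atTop :=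
    tendsto_pow_atTop_atTop_of_one_lt one_lt_two
  have hbig' : Tendsto (fun j : ℕ => 2 ^ j) atTop atTop :=
    tendsto_pow_atTop_atTop_of_one_lt (by norm_num : 1 < 2)
  obtain ⟨j, hjk, hj1, hj2⟩ := (hk.and_eventually
    ((hbig.eventually_gt_atTop (2 * ((k : ℝ) + 1) * (1 + 2 * Real.pi * K))).and
      (hbig'.eventually_ge_atTop N₀))).exists
  set A := 2 ^ j with hA
  set L := 2 ^ j / (β j + 1) with hL
  have hLA : L ≤ A := Nat.div_le_self _ _
  have hLr : (L : ℝ) ≤ A := by exact_mod_cast hLA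
  have hAr : (A : ℝ) = 2 ^ j := by rw [hA]; push_cast; rfl
  have hsum : ∑ n ∈ Finset.Ico A (A + L), fourier 1 (y n : UnitAddCircle) = S (A + L) - S A := by
    rw [hS]
    exact Finset.sum_Ico_eq_sub _ (Nat.le_add_right _ _)
  have hclose : ‖∑ n ∈ Finset.Ico A (A + L), fourier 1 (y n : UnitAddCircle) - (L : ℂ)‖ ≤
      2 * Real.pi * K := by
    have h1 : (L : ℂ) = ∑ n ∈ Finset.Ico A (A + L), fourier 1 ((0 : ℝ) : UnitAddCircle) := by
      simp
    rw [h1, ← Finset.sum_sub_distrib]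
    refine (norm_sum_le_of_le _ fun n _ => norm_fourier_sub_le 1 (y n) 0).trans ?_
    rw [← Finset.mul_sum]
    simpa using mul_le_mul_of_nonneg_left (hK j) Real.two_pi_pos.le
  have hLlow : (A : ℝ) / ((k : ℝ) + 1) - 1 ≤ L := by
    have h1 : A / (k + 1) ≤ L := by
      rw [hL, hA]
      gcongr
    have h2 : (A : ℝ) / ((k + 1 : ℕ) : ℝ) < (A / (k + 1) : ℕ) + 1 := by
      rw [← Nat.floor_div_eq_div (K := ℝ)]
      exact Nat.lt_floor_add_one _
    have h3 : ((A / (k + 1) : ℕ) : ℝ) ≤ L := by exact_mod_cast h1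
    push_cast at h2
    linarith
  have h1 := hSb (A + L) (hj2.trans (Nat.le_add_right _ _))
  have h2 := hSb A hj2
  have h3 : (L : ℝ) ≤ 2 * Real.pi * K + (‖S (A + L)‖ + ‖S A‖) := by
    calc (L : ℝ) = ‖(L : ℂ)‖ := (Complex.norm_natCast L).symm
      _ = ‖(S (A + L) - S A) -
          (∑ n ∈ Finset.Ico A (A + L), fourier 1 (y n : UnitAddCircle) - (L : ℂ))‖ := by
          rw [hsum]; congr 1; ring
      _ ≤ ‖S (A + L) - S A‖ + 2 * Real.pi * K := (norm_sub_le _ _).trans (by gcongr)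
      _ ≤ _ := by linarith [norm_sub_le (S (A + L)) (S A)]
  push_cast at h1
  have h4 : η * ((A : ℝ) + L) + η * A ≤ 3 * η * A := by nlinarith
  have h5 : 3 * η * A = (A : ℝ) / ((k : ℝ) + 1) / 2 := by
    rw [hη]; field_simp; ring
  have h6 : 1 + 2 * Real.pi * K < (A : ℝ) / ((k : ℝ) + 1) / 2 := by
    rw [hAr, div_div, lt_div_iff₀ (by positivity)]
    linarith
  linarith

end Blocks

end RecurrenceNormal

/-! ### The upper bound and the continuous reduction. -/

namespace RecurrenceNormal

theorem weylSums_congr {x y : ℕ → ℝ} (h : ∀ n, (x n : UnitAddCircle) = y n) :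
    WeylSums x ↔ WeylSums y := by
  simp only [WeylSums, h]

theorem borelPi_three_normalVectors (P : ℤ[X]) (k : ℕ) : BorelPi 3 (normalVectors P k) := by
  have h : normalVectors P k = {g : InitialValue P k | ∀ h : {h : ℤ // h ≠ 0}, Tendsto
      (fun N : ℕ => (∑ n ∈ Finset.range N, fourier (h : ℤ) (g.seq n : UnitAddCircle)) / (N : ℂ))
      atTop (𝓝 0)} := by
    ext g
    rw [Set.mem_ofPred_eq, Subtype.forall]
    exact uniformlyDistributedModOne_iff_weylSums
  rw [h]
  have : Nonempty {h : ℤ // h ≠ 0} := ⟨⟨1, one_ne_zero⟩⟩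
  refine borelPi_three_setOf_tendsto_zero fun h N => Continuous.div_const ?_ _
  exact continuous_finsetSum _ fun n _ => (map_continuous (fourier (h : ℤ))).comp
    ((AddCircle.continuous_mk' 1).comp (InitialValue.continuous_seq n))

variable {P : ℤ[X]}

/-- There is a normal vector with constant coefficients. -/
theorem exists_weylSums_const (hne : (expandingRoots P).Nonempty) :
    ∃ A : expandingRoots P → ℂ,
      WeylSums fun n => (∑ α : expandingRoots P, A α * (α : ℂ) ^ n).re := by
  classical
  obtain ⟨α, hα⟩ := hne
  obtain ⟨a, ha⟩ := exists_weylSums_re_mul_pow (one_lt_norm_of_mem_expandingRoots hα)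
  refine ⟨Pi.single ⟨α, hα⟩ a, ?_⟩
  convert! ha using 3 with n
  rw [Finset.sum_eq_single ⟨α, hα⟩]
  · simp
  · intro β _ hβ
    simp [Pi.single_eq_of_ne hβ]
  · simp

/-- The defects of the centered representatives of a real solution of the recurrence are
integers. -/
theorem exists_int_eq_defect (A : expandingRoots P → ℂ) (m : ℕ) :
    ∃ z : ℤ, ∑ j ∈ Finset.range (P.natDegree + 1), (P.coeff j : ℝ) *
      centeredFract (∑ α : expandingRoots P, A α * (α : ℂ) ^ (m + j)).re = z := by
  set x : ℕ → ℝ := fun n => (∑ α : expandingRoots P, A α * (α : ℂ) ^ n).re with hx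
  have h1 : ∑ j ∈ Finset.range (P.natDegree + 1), (P.coeff j : ℝ) * x (m + j) = 0 := by
    have h2 : ∑ j ∈ Finset.range (P.natDegree + 1), (P.coeff j : ℂ) *
        ∑ α : expandingRoots P, A α * (α : ℂ) ^ (m + j) = 0 := by
      simp only [Finset.mul_sum]
      rw [Finset.sum_comm]
      refine Finset.sum_eq_zero fun α _ => ?_
      calc _ = A α * (α : ℂ) ^ m *
            ∑ j ∈ Finset.range (P.natDegree + 1), (P.coeff j : ℂ) * (α : ℂ) ^ j := by
            rw [Finset.mul_sum]
            exact Finset.sum_congr rfl fun j _ => by rw [pow_add]; ring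
        _ = 0 := by rw [sum_coeff_mul_pow (expandingRoots_subset α.2), mul_zero]
    have h3 := congrArg Complex.re h2
    rw [Complex.re_sum, Complex.zero_re] at h3
    rw [← h3]
    refine Finset.sum_congr rfl fun j _ => ?_
    rw [← Complex.ofReal_intCast, Complex.re_ofReal_mul]
  refine ⟨-∑ j ∈ Finset.range (P.natDegree + 1), P.coeff j * ⌊x (m + j) + 1 / 2⌋, ?_⟩
  have h4 : ∀ j, centeredFract (x (m + j)) = x (m + j) - ⌊x (m + j) + 1 / 2⌋ := fun j => by
    have := Int.fract_add_floor (x (m + j) + 1 / 2)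
    unfold centeredFract
    linarith
  change ∑ j ∈ Finset.range (P.natDegree + 1), (P.coeff j : ℝ) * centeredFract (x (m + j)) = _
  simp only [h4, mul_sub, Finset.sum_sub_distrib, h1]
  push_cast
  ring

open Classical in
/-- Restriction of an integer sequence to the modified times. -/
noncomputable def restrictModified (s : ℕ → ℤ) (β : ℕ → ℕ) (m : ℕ) : ℤ :=
  if modified β m then s m else 0

/-- Whether m is modified depends on the single coordinate of β indexed by the dyadic block of m. -/
theorem continuous_restrictModified (s : ℕ → ℤ) (m : ℕ) :
    Continuous fun β => restrictModified s β m := by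
  classical
  have : (fun β => restrictModified s β m) =
      (fun b : ℕ => if 1 ≤ m ∧ m < 2 ^ Nat.log 2 m + 2 ^ Nat.log 2 m / (b + 1) then s m else 0) ∘
        fun β : ℕ → ℕ => β (Nat.log 2 m) := by
    funext β
    simp only [restrictModified, modified, Function.comp_apply]
    congr
  rw [this]
  exact continuous_of_discreteTopology.comp (continuous_apply _)

theorem abs_restrictModified_le {s : ℕ → ℤ} {M : ℝ} (hs : ∀ m, |(s m : ℝ)| ≤ M) (β : ℕ → ℕ)
    (m : ℕ) : |(restrictModified s β m : ℝ)| ≤ M := by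
  unfold restrictModified
  split_ifs
  · exact hs m
  · simpa using (abs_nonneg _).trans (hs m)

theorem exists_continuous_reduction (k : ℕ) (hmonic : P.Monic) (hdeg : 1 ≤ P.natDegree)
    (hconst : P.coeff 0 ≠ 0) (hroots : (P.aroots ℂ).Nodup)
    (hunit : ∀ z : ℂ, ‖z‖ = 1 → Polynomial.aeval z P ≠ 0) :
    ∃ φ : (ℕ → ℕ) → InitialValue P k, Continuous φ ∧
      φ ⁻¹' normalVectors P k = {β : ℕ → ℕ | Tendsto β atTop atTop} := by
  classical
  obtain ⟨A, hA⟩ := exists_weylSums_const (expandingRoots_nonempty hmonic hdeg hconst hunit)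
  obtain ⟨C, θ, hC, h0, h1, hc⟩ := exists_kernel_bound hunit
  have hrec := kernel_recurrence hmonic hdeg hroots
  set x : ℕ → ℝ := fun n => (∑ α : expandingRoots P, A α * (α : ℂ) ^ n).re with hx
  set ε : ℕ → ℝ := fun n => centeredFract (x n) with hε
  have hε1 : ∀ n, |ε n| ≤ 1 := fun n => by
    have := centeredFract_mem (x n)
    rw [abs_le]
    constructor <;> linarith [this.1, this.2]
  have hWε : WeylSums ε := (weylSums_congr fun n => coe_centeredFract (x n)).mpr hA
  have hD := geomSum_nonneg h0
  choose s hs using exists_int_eq_defect A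
  have hsε : ∀ m, (s m : ℝ) =
      ∑ j ∈ Finset.range (P.natDegree + 1), (P.coeff j : ℝ) * ε (m + j) := fun m => (hs m).symm
  set M : ℝ := ∑ j ∈ Finset.range (P.natDegree + 1), |(P.coeff j : ℝ)| with hM
  have hM0 : 0 ≤ M := Finset.sum_nonneg fun _ _ => abs_nonneg _
  have hsM : ∀ m, |(s m : ℝ)| ≤ M := fun m => by
    rw [hsε]
    refine (Finset.abs_sum_le_sum_abs _ _).trans (Finset.sum_le_sum fun j _ => ?_)
    rw [abs_mul]
    exact mul_le_of_le_one_right (abs_nonneg _) (hε1 _)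
  have hσM := fun β => abs_restrictModified_le hsM β
  have hsumm : ∀ β n, Summable fun m : ℕ => (restrictModified s β m : ℝ) * kernel P ((n : ℕ) - m) :=
    fun β n => summable_mul_kernel h0 h1 hc (hσM β) n
  let φ : (ℕ → ℕ) → InitialValue P k := fun β =>
    InitialValue.ofConst k fun α => A α + defectCoeff P (restrictModified s β) α
  have hφc : Continuous φ := InitialValue.continuous_ofConst fun α =>
    continuous_const.add (continuous_defectCoeff hσM (continuous_restrictModified s) α)
  let δ : (ℕ → ℕ) → ℕ → ℝ := fun β n =>
    ∑' m : ℕ, (restrictModified s β m : ℝ) * kernel P (n - m)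
  have hφseq : ∀ β n, ((φ β).seq n : UnitAddCircle) = ((ε n + -δ β n : ℝ) : UnitAddCircle) := by
    intro β n
    obtain ⟨z, hz⟩ := exists_int_sum_defectCoeff hmonic hroots (hσM β) n (hsumm β n)
    have h2 : (φ β).seq n = x n + -δ β n + z := by
      rw [InitialValue.seq_ofConst]
      simp only [add_mul, Finset.sum_add_distrib, Complex.add_re, hz]
      simp only [x, δ]
      ring
    rw [h2, coe_add_intCast, AddCircle.coe_add, AddCircle.coe_add, coe_centeredFract]
  refine ⟨φ, hφc, ?_⟩
  ext β
  have hmem : β ∈ φ ⁻¹' normalVectors P k ↔ WeylSums fun n => ε n + -δ β n :=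
    uniformlyDistributedModOne_iff_weylSums.trans (weylSums_congr (hφseq β))
  rw [hmem]
  constructor
  · intro hW
    by_contra hβ
    -- The defects left unmodified. Up to an exponentially small error ε - δ β is τ * c, and τ
    -- vanishes on the modified part of each block, so the block error there is bounded
    -- independently of j.
    set τ : ℕ → ℝ := fun m => (s m : ℝ) - restrictModified s β m with hτ
    have hτ0 : ∀ m, modified β m → τ m = 0 := fun m hm => by simp [τ, restrictModified, hm]
    have hτM : ∀ m, |τ m| ≤ M := fun m => by
      by_cases hm : modified β m
      · rw [hτ0 m hm, abs_zero]; exact hM0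
      · simpa [τ, restrictModified, hm] using hsM m
    set C' : ℝ := C * ∑ j ∈ Finset.range (P.natDegree + 1), |(P.coeff j : ℝ)| * j with hC'
    have hC'0 : 0 ≤ C' := by positivity
    refine not_weylSums_of_blocks (K := C' * (1 - θ)⁻¹ +
      M * C * geomSum θ * (2 * geomSum θ)) (fun j => ?_) hβ hW
    have hdecomp : ∀ n, |ε n + -δ β n| ≤ C' * θ ^ n +
        |∑' m : ℕ, τ m * kernel P ((n : ℤ) - m)| := fun n => by
      have h2 := abs_sub_convolution_defect_le h0 h1 hc hrec hε1 n
      simp only [← hsε] at h2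
      have h3 : ∑' m : ℕ, τ m * kernel P ((n : ℤ) - m) =
          ∑' m : ℕ, (s m : ℝ) * kernel P ((n : ℤ) - m) - δ β n := by
        rw [← (summable_mul_kernel h0 h1 hc hsM n).tsum_sub (hsumm β n)]
        exact tsum_congr fun m => by simp only [τ]; ring
      have h4 : ε n + -δ β n = (ε n - ∑' m : ℕ, (s m : ℝ) * kernel P ((n : ℤ) - m)) +
          ∑' m : ℕ, τ m * kernel P ((n : ℤ) - m) := by
        rw [h3]; ring
      rw [h4]
      exact (abs_add_le _ _).trans (by gcongr)
    refine (Finset.sum_le_sum fun n _ => hdecomp n).trans ?_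
    rw [Finset.sum_add_distrib, ← Finset.mul_sum]
    have h5 := sum_Ico_abs_convolution_le h0 h1 hC hc hτM (2 ^ j) (2 ^ j + 2 ^ j / (β j + 1))
    rw [Finset.filter_eq_empty_iff.mpr
      (fun m hm => not_not.mpr (hτ0 m (modified_of_mem_Ico hm))), Finset.card_empty,
      Nat.cast_zero, zero_add] at h5
    gcongr
    rw [← tsum_geometric_of_lt_one h0.le h1]
    exact (summable_geometric_of_lt_one h0.le h1).sum_le_tsum _ fun _ _ => by positivity
  · intro hβ
    -- The perturbation up to N has total size O(number of modified times + 1), which is o(N) when β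
    -- tends to infinity.
    refine WeylSums.of_perturbation (δ := fun n => -δ β n) (fun n => rfl) ?_ hWε
    have h2 := ((tendsto_card_modified_div hβ).add
      (tendsto_const_div_atTop_nhds_zero_nat (2 * geomSum θ))).const_mul (M * C * geomSum θ)
    rw [add_zero, mul_zero] at h2
    refine squeeze_zero (fun N => by positivity) (fun N => ?_) h2
    rw [← add_div, ← mul_div_assoc]
    gcongr
    have h3 := sum_Ico_abs_convolution_le h0 h1 hC hc (hσM β) 0 N
    rw [Nat.Ico_zero_eq_range] at h3
    simp only [abs_neg]
    refine h3.trans ?_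
    gcongr with m
    intro hm
    by_contra hmod
    exact hm (by simp [restrictModified, hmod])

end RecurrenceNormal

theorem theorem1 (P : ℤ[X]) (k : ℕ)
    (hmonic : P.Monic) (hdeg : 1 ≤ P.natDegree) (hconst : P.coeff 0 ≠ 0)
    (hroots : (P.aroots ℂ).Nodup)
    (hunit : ∀ z : ℂ, ‖z‖ = 1 → Polynomial.aeval z P ≠ 0) :
    RecurrenceNormal.BorelPiComplete 3 (RecurrenceNormal.normalVectors P k) ∧
      ∃ φ : (ℕ → ℕ) → RecurrenceNormal.InitialValue P k, Continuous φ ∧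
        φ ⁻¹' RecurrenceNormal.normalVectors P k = {β : ℕ → ℕ | Tendsto β atTop atTop} := by
  obtain ⟨φ, hφ, hpre⟩ := RecurrenceNormal.exists_continuous_reduction k hmonic hdeg hconst hroots
    hunit
  refine ⟨⟨RecurrenceNormal.borelPi_three_normalVectors P k, fun h => ?_⟩, φ, hφ, hpre⟩
  exact RecurrenceNormal.not_borelSigma_three_tendsto_atTop (hpre ▸ h.preimage hφ)
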